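/- Let $0<a<b$. Write $S_r^2=\{q\in\mathbb{R}^3: |q|=r\}$ for $r>0$, and let $Sh_{(a,b)}=\{q\in\mathbb{R}^3: a\le |q|\le b\}$ be the closed shell, a smooth manifold with boundary $S_a^2\cup S_b^2$. All bundles are smooth complex line bundles with a smooth Hermitian metric. Two line bundles $\pi_1:E_1\to P$ and $\pi_2:E_2\to Q$, possibly over different base manifolds, are called isomorphic if there is a diffeomorphism $\phi:E_1\to E_2$ of total spaces such that for every $p\in P$ there is $q\in Q$ for which $\phi$ restricts to a complex-linear isomorphism $\pi_1^{-1}(p)\to\pi_2^{-1}(q)$. For a line bundle $L\to S_r^2$, the first Chern number is $$n_c(L\to S_r^2)=\int_{S_r^2}\frac{\mathrm{i}}{2\pi}\,\theta ,$$ where $\theta=\mathrm{d}\chi$ is the curvature of a smooth complex-linear connection on $L$ with local connection forms $\chi$, and $S_r^2$ is oriented by the outward normal. Let $E\to Sh_{(a,b)}$ be a Hermitian line bundle. Then: (i) The restrictions $E|_{S_a^2}$ and $E|_{S_b^2}$ are isomorphic. (ii) They have the same first Chern number: each of the two restrictions admits a smooth connection, the integral defining $n_c$ does not depend on the connection, and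 $n_c(E\to S_a^2)=n_c(E\to S_b^2)$. (iii) (Topological charge.) Let $R>0$ and let $E$ be a Hermitian line bundle over the punctured ball $\{q\in\mathbb{R}^3: 0<|q|<R\}$, as is the case for the bundle of a non-degenerate eigenmode around an isolated Weyl point placed at the origin. Then the number $n_c(E\to S_r^2)$ exists, does not depend on the connection used to compute it, and is the same for all $0<r<R$. -/

import Mathlib

open scoped Manifold ContDiff Topology
open Bundle

universe u

noncomputable section

namespace WeylSphere

/-! ### Transporting a smooth structure along a homeomorphism -/

section Transport

variable {H M N : Type*} [TopologicalSpace H] [TopologicalSpace M] [TopologicalSpace N]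
  [ChartedSpace H N]

/-- The charts of `N`, composed with a homeomorphism `h : M ≃ₜ N`, as charts of `M`. -/
@[reducible] def transportCharts (h : M ≃ₜ N) : ChartedSpace H M where
  atlas := (fun c => h.toOpenPartialHomeomorph ≫ₕ c) '' atlas H N
  chartAt x := h.toOpenPartialHomeomorph ≫ₕ chartAt H (h x)
  mem_chart_source x := by simp
  chart_mem_atlas x := ⟨chartAt H (h x), chart_mem_atlas H (h x), rfl⟩

variable {E : Type*} [NormedAddCommGroup E] [NormedSpace ℝ E] (I : ModelWithCorners ℝ E H)

theorem isManifold_transportCharts {n : WithTop ℕ∞} [IsManifold I n N] (h : M ≃ₜ N) :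
    let _ : ChartedSpace H M := transportCharts h
    IsManifold I n M := by
  intro _
  have : HasGroupoid M (contDiffGroupoid n I) := by
    refine ⟨?_⟩
    rintro _ _ ⟨c, hc, rfl⟩ ⟨c', hc', rfl⟩
    have := HasGroupoid.compatible (G := contDiffGroupoid n I) hc hc'
    refine (contDiffGroupoid n I).mem_of_eqOnSource this ?_
    refine ⟨?_, ?_⟩
    · ext x; simp
    · intro x hx; simp
  exact IsManifold.mk' I n M

theorem contMDiff_transport {n : WithTop ℕ∞} [IsManifold I n N] (h : M ≃ₜ N) :
    let _ : ChartedSpace H M := transportCharts h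
    ContMDiff I I n h := by
  intro _ x
  have hc : ∀ y : M, chartAt H y = h.toOpenPartialHomeomorph ≫ₕ chartAt H (h y) := fun _ => rfl
  have hN : ContMDiffAt I I n (id : N → N) (h x) := contMDiffAt_id
  rw [contMDiffAt_iff] at hN ⊢
  refine ⟨h.continuous.continuousAt, ?_⟩
  refine (hN.2.congr_of_eventuallyEq ?_ ?_)
  · filter_upwards with y
    simp [extChartAt, hc]
  · simp [extChartAt, hc]

theorem contMDiff_transport_symm {n : WithTop ℕ∞} [IsManifold I n N] (h : M ≃ₜ N) :
    let _ : ChartedSpace H M := transportCharts h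
    ContMDiff I I n h.symm := by
  intro _ x
  have hc : ∀ y : M, chartAt H y = h.toOpenPartialHomeomorph ≫ₕ chartAt H (h y) := fun _ => rfl
  have hN : ContMDiffAt I I n (id : N → N) x := contMDiffAt_id
  rw [contMDiffAt_iff] at hN ⊢
  refine ⟨h.symm.continuous.continuousAt, ?_⟩
  refine (hN.2.congr_of_eventuallyEq ?_ ?_)
  · filter_upwards with y
    simp [extChartAt, hc]
  · simp [extChartAt, hc]

end Transport

/-! ### Spheres, shells and punctured balls in `ℝ³` -/

/-- The parameter space `ℝ³` with its Euclidean norm. -/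
abbrev R3 : Type := EuclideanSpace ℝ (Fin 3)

/-- The sphere `S_r²` of radius `r > 0` about the origin of `ℝ³`. -/
def Sphere (r : ℝ) (_ : 0 < r) : Type := {q : R3 // ‖q‖ = r}

/-- The closed shell of inner radius `a` and outer radius `b` about the origin of `ℝ³`. -/
def Shell (a b : ℝ) (_ : 0 < a) (_ : a < b) : Type := {q : R3 // a ≤ ‖q‖ ∧ ‖q‖ ≤ b}

/-- The punctured open ball `{q | 0 < |q| < R}` about the origin of `ℝ³`. -/
def puncturedBall (R : ℝ) : TopologicalSpace.Opens R3 where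
  carrier := {q | 0 < ‖q‖ ∧ ‖q‖ < R}
  is_open' := (isOpen_lt continuous_const continuous_norm).inter
    (isOpen_lt continuous_norm continuous_const)

/-- The unit sphere with Mathlib's manifold structure. -/
abbrev UnitSphere : Type := Metric.sphere (0 : R3) 1

instance : Fact (Module.finrank ℝ R3 = 2 + 1) := ⟨finrank_euclideanSpace_fin⟩

instance (r : ℝ) (hr : 0 < r) : TopologicalSpace (Sphere r hr) :=
  inferInstanceAs (TopologicalSpace {q : R3 // ‖q‖ = r})

instance (a b : ℝ) (ha : 0 < a) (hab : a < b) : TopologicalSpace (Shell a b ha hab) :=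
  inferInstanceAs (TopologicalSpace {q : R3 // a ≤ ‖q‖ ∧ ‖q‖ ≤ b})

theorem Sphere.continuous_val (r : ℝ) (hr : 0 < r) :
    Continuous (fun q : Sphere r hr => (q.1 : R3)) := continuous_subtype_val

/-- The scaling `q ↦ q / r` from the sphere of radius `r` to the unit sphere. -/
def Sphere.scale (r : ℝ) (hr : 0 < r) : Sphere r hr ≃ₜ UnitSphere where
  toFun q := ⟨r⁻¹ • q.1, by
    rw [mem_sphere_zero_iff_norm, norm_smul, q.2, norm_inv, Real.norm_of_nonneg hr.le,
      inv_mul_cancel₀ hr.ne']⟩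
  invFun x := ⟨r • x.1, by
    rw [norm_smul, mem_sphere_zero_iff_norm.1 x.2, Real.norm_of_nonneg hr.le, mul_one]⟩
  left_inv q := Subtype.ext (smul_inv_smul₀ hr.ne' q.1)
  right_inv x := Subtype.ext (inv_smul_smul₀ hr.ne' x.1)
  continuous_toFun := Continuous.subtype_mk ((Sphere.continuous_val r hr).const_smul r⁻¹) _
  continuous_invFun := Continuous.subtype_mk
    ((continuous_subtype_val (p := fun x : R3 => x ∈ Metric.sphere (0 : R3) 1)).const_smul r) _

/-- Polar coordinates `q ↦ (q / |q|, |q|)` on the shell. -/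
def Shell.polar (a b : ℝ) (ha : 0 < a) (hab : a < b) :
    Shell a b ha hab ≃ₜ UnitSphere × Set.Icc a b where
  toFun q := (⟨‖q.1‖⁻¹ • q.1, by
    rw [mem_sphere_zero_iff_norm, norm_smul, norm_inv, norm_norm,
      inv_mul_cancel₀ (ha.trans_le q.2.1).ne']⟩, ⟨‖q.1‖, q.2⟩)
  invFun x := ⟨x.2.1 • x.1.1, by
    rw [norm_smul, mem_sphere_zero_iff_norm.1 x.1.2, mul_one,
      Real.norm_of_nonneg (ha.le.trans x.2.2.1)]
    exact x.2.2⟩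
  left_inv q := Subtype.ext (smul_inv_smul₀ (ha.trans_le q.2.1).ne' q.1)
  right_inv x := by
    have h0 : 0 < x.2.1 := ha.trans_le x.2.2.1
    have h1 : ‖x.2.1 • x.1.1‖ = x.2.1 := by
      rw [norm_smul, mem_sphere_zero_iff_norm.1 x.1.2, mul_one, Real.norm_of_nonneg h0.le]
    refine Prod.ext (Subtype.ext ?_) (Subtype.ext h1)
    change ‖x.2.1 • x.1.1‖⁻¹ • x.2.1 • x.1.1 = x.1.1
    rw [h1, inv_smul_smul₀ h0.ne']
  continuous_toFun := by
    refine Continuous.prodMk (Continuous.subtype_mk ?_ _) (Continuous.subtype_mk ?_ _)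
    · exact (continuous_subtype_val.norm.inv₀ fun q => (ha.trans_le q.2.1).ne').smul
        continuous_subtype_val
    · exact continuous_subtype_val.norm
  continuous_invFun := Continuous.subtype_mk
    ((continuous_subtype_val.comp continuous_snd).smul
      (continuous_subtype_val.comp continuous_fst)) _

/-- The smooth structure of `S_r²`: the one that makes `q ↦ q / r` a diffeomorphism onto the
unit sphere. -/
instance (r : ℝ) (hr : 0 < r) : ChartedSpace (EuclideanSpace ℝ (Fin 2)) (Sphere r hr) :=
  transportCharts (Sphere.scale r hr)

instance (r : ℝ) (hr : 0 < r) : IsManifold (𝓡 2) ∞ (Sphere r hr) :=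
  isManifold_transportCharts (𝓡 2) (Sphere.scale r hr)

/-- The model with boundary of the shell. -/
abbrev shellModel : ModelWithCorners ℝ (EuclideanSpace ℝ (Fin 2) × EuclideanSpace ℝ (Fin 1))
    (ModelProd (EuclideanSpace ℝ (Fin 2)) (EuclideanHalfSpace 1)) := (𝓡 2).prod (𝓡∂ 1)

/-- The smooth structure, with boundary, of the closed shell: the one that makes polar coordinates
a diffeomorphism onto the product of the unit sphere and the interval `[a, b]`. -/
instance (a b : ℝ) (ha : 0 < a) (hab : a < b) :
    ChartedSpace (ModelProd (EuclideanSpace ℝ (Fin 2)) (EuclideanHalfSpace 1))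
      (Shell a b ha hab) :=
  have : Fact (a < b) := ⟨hab⟩
  transportCharts (Shell.polar a b ha hab)

instance (a b : ℝ) (ha : 0 < a) (hab : a < b) :
    IsManifold shellModel ∞ (Shell a b ha hab) :=
  have : Fact (a < b) := ⟨hab⟩
  isManifold_transportCharts shellModel (Shell.polar a b ha hab)

theorem Sphere.contMDiff_scale (r : ℝ) (hr : 0 < r) :
    ContMDiff (𝓡 2) (𝓡 2) ∞ (Sphere.scale r hr) :=
  contMDiff_transport (𝓡 2) (Sphere.scale r hr)

theorem Sphere.contMDiff_scale_symm (r : ℝ) (hr : 0 < r) :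
    ContMDiff (𝓡 2) (𝓡 2) ∞ (Sphere.scale r hr).symm :=
  contMDiff_transport_symm (𝓡 2) (Sphere.scale r hr)

theorem Shell.contMDiff_polar_symm (a b : ℝ) (ha : 0 < a) (hab : a < b) :
    have : Fact (a < b) := ⟨hab⟩
    ContMDiff shellModel shellModel ∞ (Shell.polar a b ha hab).symm :=
  have : Fact (a < b) := ⟨hab⟩
  contMDiff_transport_symm shellModel (Shell.polar a b ha hab)

theorem Sphere.contMDiff_val (r : ℝ) (hr : 0 < r) :
    ContMDiff (𝓡 2) 𝓘(ℝ, R3) ∞ (fun q : Sphere r hr => (q.1 : R3)) := by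
  have h := (contMDiff_coe_sphere (E := R3) (n := 2) (m := ∞)).comp
    (Sphere.contMDiff_scale r hr)
  have h2 := (contDiff_const_smul (𝕜 := ℝ) (F := R3) (n := ∞) r).contMDiff.comp h
  refine h2.congr fun q => ?_
  exact (smul_inv_smul₀ hr.ne' q.1).symm

/-- The inclusion of `S_r²` into the shell, for `a ≤ r ≤ b`. -/
def Sphere.toShell {a b : ℝ} (ha : 0 < a) (hab : a < b) (r : ℝ) (hr : 0 < r)
    (har : a ≤ r) (hrb : r ≤ b) :
    ContMDiffMap (𝓡 2) shellModel (Sphere r hr) (Shell a b ha hab) ∞ :=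
  ⟨fun q => ⟨q.1, q.2.symm ▸ har, q.2.symm ▸ hrb⟩, by
    have : Fact (a < b) := ⟨hab⟩
    have h : ContMDiff (𝓡 2) shellModel ∞ (fun q : Sphere r hr =>
        ((Sphere.scale r hr q, ⟨r, har, hrb⟩) : UnitSphere × Set.Icc a b)) :=
      (Sphere.contMDiff_scale r hr).prodMk contMDiff_const
    refine ((Shell.contMDiff_polar_symm a b ha hab).comp h).congr fun q => ?_
    exact Subtype.ext (smul_inv_smul₀ hr.ne' q.1).symm⟩

/-- The inclusion of `S_r²` into the punctured ball of radius `R`, for `0 < r < R`. -/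
def Sphere.toPuncturedBall {R : ℝ} (r : ℝ) (hr : 0 < r) (hrR : r < R) :
    ContMDiffMap (𝓡 2) 𝓘(ℝ, R3) (Sphere r hr) (puncturedBall R) ∞ :=
  ⟨fun q => ⟨q.1, by rw [q.2]; exact hr, by rw [q.2]; exact hrR⟩,
    (ContMDiff.subtypeVal_comp_iff _ _).1 (Sphere.contMDiff_val r hr)⟩

/-- Spherical coordinates on `S_r²`,
`(u, v) ↦ r (sin u cos v, sin u sin v, cos u)`. On `(0, π) × (0, 2π)` they parametrize the sphere
up to a null set, and `(∂/∂u, ∂/∂v)` is positively oriented for the outward normal. -/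
def Sphere.spherical (r : ℝ) (hr : 0 < r) (x : ℝ × ℝ) : Sphere r hr :=
  ⟨r • !₂[Real.sin x.1 * Real.cos x.2, Real.sin x.1 * Real.sin x.2, Real.cos x.1], by
    have h : ‖!₂[Real.sin x.1 * Real.cos x.2, Real.sin x.1 * Real.sin x.2, Real.cos x.1]‖ = 1 := by
      rw [EuclideanSpace.norm_eq, Real.sqrt_eq_one, Fin.sum_univ_three]
      simp only [Real.norm_eq_abs, sq_abs]
      simp
      nlinarith [Real.sin_sq_add_cos_sq x.1, Real.sin_sq_add_cos_sq x.2]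
    rw [norm_smul, h, mul_one, Real.norm_of_nonneg hr.le]⟩

theorem Sphere.contMDiff_spherical (r : ℝ) (hr : 0 < r) :
    ContMDiff 𝓘(ℝ, ℝ × ℝ) (𝓡 2) ∞ (Sphere.spherical r hr) := by
  have h0 : ContMDiff 𝓘(ℝ, ℝ × ℝ) 𝓘(ℝ, R3) ∞ (fun x : ℝ × ℝ =>
      (!₂[Real.sin x.1 * Real.cos x.2, Real.sin x.1 * Real.sin x.2, Real.cos x.1] : R3)) := by
    refine ContDiff.contMDiff ?_
    rw [contDiff_euclidean]
    intro i
    fin_cases i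
    · exact (Real.contDiff_sin.comp contDiff_fst).mul (Real.contDiff_cos.comp contDiff_snd)
    · exact (Real.contDiff_sin.comp contDiff_fst).mul (Real.contDiff_sin.comp contDiff_snd)
    · exact Real.contDiff_cos.comp contDiff_fst
  have h1 : ∀ x : ℝ × ℝ, (!₂[Real.sin x.1 * Real.cos x.2, Real.sin x.1 * Real.sin x.2,
      Real.cos x.1] : R3) ∈ Metric.sphere (0 : R3) 1 := by
    intro x
    rw [mem_sphere_zero_iff_norm, EuclideanSpace.norm_eq, Real.sqrt_eq_one, Fin.sum_univ_three]
    simp only [Real.norm_eq_abs, sq_abs]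
    simp
    nlinarith [Real.sin_sq_add_cos_sq x.1, Real.sin_sq_add_cos_sq x.2]
  exact (Sphere.contMDiff_scale_symm r hr).comp (h0.codRestrict_sphere (n := 2) h1)

/-! ### Hermitian line bundles -/

theorem isLinear_real {B : Type*} [TopologicalSpace B] (F : B → Type u)
    [∀ x, NormedAddCommGroup (F x)] [∀ x, NormedSpace ℂ (F x)] [TopologicalSpace (TotalSpace ℂ F)]
    [FiberBundle ℂ F] [VectorBundle ℂ ℂ F] (e : Trivialization ℂ (π ℂ F))
    [MemTrivializationAtlas e] : e.IsLinear ℝ :=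
  ⟨fun b hb => ⟨(e.linear ℂ hb).map_add, fun c x => by
    simpa using (e.linear ℂ hb).map_smul (c : ℂ) x⟩⟩

/-- A complex vector bundle is in particular a real vector bundle. -/
instance vectorBundleReal {B : Type*} [TopologicalSpace B] (F : B → Type u)
    [∀ x, NormedAddCommGroup (F x)] [∀ x, NormedSpace ℂ (F x)] [TopologicalSpace (TotalSpace ℂ F)]
    [FiberBundle ℂ F] [VectorBundle ℂ ℂ F] : VectorBundle ℝ ℂ F where
  trivialization_linear' e _ := isLinear_real F e
  continuousOn_coordChange' e e' _ _ := by
    have := isLinear_real F e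
    have := isLinear_real F e'
    have h := (ContinuousLinearMap.restrictScalarsL ℂ ℂ ℂ ℝ ℝ).continuous.comp_continuousOn
      (continuousOn_coordChange ℂ e e')
    refine h.congr fun b hb => ?_
    ext v
    change e.coordChangeL ℝ e' b v = e.coordChangeL ℂ e' b v
    rw [e.coordChangeL_apply e' hb, e.coordChangeL_apply e' hb]

variable {EB HB : Type*} [NormedAddCommGroup EB] [NormedSpace ℝ EB] [TopologicalSpace HB]

/-- A smooth Hermitian line bundle over a smooth manifold `B` (possibly with boundary): a complex
vector bundle with model fiber `ℂ`, whose transition functions are smooth over the real manifold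
`B`, with a Hermitian inner product on each fiber whose coefficients in the local frames are
smooth. -/
structure HermitianLineBundle (I : ModelWithCorners ℝ EB HB) (B : Type*) [TopologicalSpace B]
    [ChartedSpace HB B] where
  /-- The fibers. -/
  Fiber : B → Type u
  [normedAddCommGroup : ∀ x, NormedAddCommGroup (Fiber x)]
  [innerProductSpace : ∀ x, InnerProductSpace ℂ (Fiber x)]
  [topologicalSpace : TopologicalSpace (TotalSpace ℂ Fiber)]
  [fiberBundle : FiberBundle ℂ Fiber]
  [vectorBundle : VectorBundle ℂ ℂ Fiber]
  [contMDiffVectorBundle : ContMDiffVectorBundle ∞ ℂ Fiber I]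
  contMDiffOn_inner : ∀ (e : Trivialization ℂ (π ℂ Fiber)) [MemTrivializationAtlas e] (z w : ℂ),
    ContMDiffOn I 𝓘(ℝ, ℂ) ∞ (fun x => inner ℂ (e.symm x z) (e.symm x w)) e.baseSet

attribute [instance] HermitianLineBundle.normedAddCommGroup
  HermitianLineBundle.innerProductSpace HermitianLineBundle.topologicalSpace
  HermitianLineBundle.fiberBundle HermitianLineBundle.vectorBundle
  HermitianLineBundle.contMDiffVectorBundle

namespace HermitianLineBundle

variable {I : ModelWithCorners ℝ EB HB} {B : Type*} [TopologicalSpace B] [ChartedSpace HB B]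
  {EB' HB' : Type*} [NormedAddCommGroup EB'] [NormedSpace ℝ EB'] [TopologicalSpace HB']
  {I' : ModelWithCorners ℝ EB' HB'} {B' : Type*} [TopologicalSpace B'] [ChartedSpace HB' B']

/-- The total space of a Hermitian line bundle. -/
abbrev Total (L : HermitianLineBundle.{u} I B) : Type _ := TotalSpace ℂ L.Fiber

/-- The pullback `f^*L` of a Hermitian line bundle along a smooth map; for the inclusion of a
submanifold, this is the restriction of `L`. -/
def pullback (L : HermitianLineBundle.{u} I B) (f : ContMDiffMap I' I B' B ∞) :
    HermitianLineBundle.{u} I' B' where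
  Fiber := fun x => L.Fiber (f x)
  normedAddCommGroup x := L.normedAddCommGroup (f x)
  innerProductSpace x := L.innerProductSpace (f x)
  topologicalSpace := Pullback.TotalSpace.topologicalSpace ℂ L.Fiber f
  fiberBundle := FiberBundle.pullback (E := L.Fiber) f
  vectorBundle := VectorBundle.pullback ℂ (E := L.Fiber) f
  contMDiffVectorBundle := ContMDiffVectorBundle.pullback ℂ L.Fiber I' f
  contMDiffOn_inner := by
    rintro _ ⟨e, he, rfl⟩ z w
    refine ((L.contMDiffOn_inner e z w).comp f.contMDiff.contMDiffOn fun b hb => hb).congr ?_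
    intro b hb
    have key : ∀ y : ℂ, (e.pullback f).symm b y = e.symm (f b) y := fun y =>
      TotalSpace.mk_inj.1 ((e.pullback f).mk_symm hb y)
    exact congrArg₂ (fun s t : L.Fiber (f b) => (inner ℂ s t : ℂ)) (key z) (key w)

/-- Two line bundles `L → P` and `L' → Q`, possibly over different base manifolds, are isomorphic
if there is a diffeomorphism of their total spaces that maps each fiber of `L` onto a fiber of `L'`
by an isomorphism of complex vector spaces. -/
def Isomorphic (L : HermitianLineBundle.{u} I B) (L' : HermitianLineBundle.{u} I' B') : Prop :=
  ∃ φ : Diffeomorph (I.prod 𝓘(ℝ, ℂ)) (I'.prod 𝓘(ℝ, ℂ)) L.Total L'.Total ∞,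
    ∀ p : B, ∃ (q : B') (A : L.Fiber p ≃ₗ[ℂ] L'.Fiber q), ∀ v : L.Fiber p, φ ⟨p, v⟩ = ⟨q, A v⟩

/-! ### Connections, curvature and the first Chern number -/

/-- A smooth connection on a complex line bundle: a smooth covariant derivative that commutes with
multiplication by complex constants. -/
structure Connection [IsManifold I ∞ B] (L : HermitianLineBundle.{u} I B) where
  /-- The covariant derivative, `cov σ x X = ∇_X σ (x)`. -/
  cov : CovariantDerivative I ℂ L.Fiber
  contMDiff_cov : cov.ContMDiffCovariantDerivative ∞
  cov_smul : ∀ (c : ℂ) (σ : ∀ x, L.Fiber x) (x : B),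
    MDifferentiableAt I (I.prod 𝓘(ℝ, ℂ)) (fun y => (⟨y, σ y⟩ : L.Total)) x →
    ∀ X : TangentSpace I x, cov (fun y => c • σ y) x X = c • cov σ x X

/-- The local frame of `L` around `p` given by the preferred local trivialization at `p`. -/
def frame (L : HermitianLineBundle.{u} I B) (p x : B) : L.Fiber x :=
  (trivializationAt ℂ L.Fiber p).symm x 1

namespace Connection

variable [IsManifold I ∞ B] {L : HermitianLineBundle.{u} I B}

/-- The local connection form `χ` around `p`: the `ℂ`-valued one-form with `∇ s = χ ⊗ s` for
`s = L.frame p`. -/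
def form (D : L.Connection) (p x : B) : TangentSpace I x →L[ℝ] ℂ :=
  ((trivializationAt ℂ L.Fiber p).continuousLinearMapAt ℝ x).comp (D.cov (L.frame p) x)

/-- The pullback `Φ^*χ` of the local connection form around `p` along a map `Φ : ℝ² → B`. -/
def pullbackForm (D : L.Connection) (Φ : ℝ × ℝ → B) (p : B) (x : ℝ × ℝ) : ℝ × ℝ →L[ℝ] ℂ :=
  (D.form p (Φ x)).comp (mfderiv 𝓘(ℝ, ℝ × ℝ) I Φ x)

/-- The component `θ(∂Φ/∂u, ∂Φ/∂v)` at `x = (u, v)` of the curvature two-form `θ = dχ`, along a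
smooth map `Φ : ℝ² → B`; it is computed from `Φ^*θ = d(Φ^*χ)`, where `χ` is the local connection
form around `Φ x`. -/
def curvatureAlong (D : L.Connection) (Φ : ℝ × ℝ → B) (x : ℝ × ℝ) : ℂ :=
  fderiv ℝ (D.pullbackForm Φ (Φ x)) x (1, 0) (0, 1) -
    fderiv ℝ (D.pullbackForm Φ (Φ x)) x (0, 1) (1, 0)

/-- The integral `∫ (i / 2π) θ` of the first Chern form of a connection over the sphere `S_r²`,
oriented by the outward normal, in spherical coordinates. -/
def chernIntegral {r : ℝ} {hr : 0 < r} {L : HermitianLineBundle.{u} (𝓡 2) (Sphere r hr)}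
    (D : L.Connection) : ℂ :=
  ∫ u in (0 : ℝ)..Real.pi, ∫ v in (0 : ℝ)..(2 * Real.pi),
    Complex.I / (2 * Real.pi) * D.curvatureAlong (Sphere.spherical r hr) (u, v)

end Connection

/-- `n` is the first Chern number of the line bundle `L → S_r²`: connections on `L` exist, and the
integral of the first Chern form over the sphere equals `n` for every connection on `L`. -/
def IsFirstChernNumber {r : ℝ} {hr : 0 < r} (L : HermitianLineBundle.{u} (𝓡 2) (Sphere r hr))
    (n : ℂ) : Prop :=
  Nonempty L.Connection ∧ ∀ D : L.Connection, D.chernIntegral = n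

/-- The restriction of a line bundle over the shell to its inner boundary sphere `S_a²`. -/
def restrictInner {a b : ℝ} {ha : 0 < a} {hab : a < b}
    (L : HermitianLineBundle.{u} shellModel (Shell a b ha hab)) :
    HermitianLineBundle.{u} (𝓡 2) (Sphere a ha) :=
  L.pullback (Sphere.toShell ha hab a ha le_rfl hab.le)

/-- The restriction of a line bundle over the shell to its outer boundary sphere `S_b²`. -/
def restrictOuter {a b : ℝ} {ha : 0 < a} {hab : a < b}
    (L : HermitianLineBundle.{u} shellModel (Shell a b ha hab)) :
    HermitianLineBundle.{u} (𝓡 2) (Sphere b (ha.trans hab)) :=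
  L.pullback (Sphere.toShell ha hab b (ha.trans hab) hab.le le_rfl)

/-- The restriction of a line bundle over the punctured ball of radius `R` to the sphere `S_r²`,
for `0 < r < R`. -/
def restrictSphere {R : ℝ} (L : HermitianLineBundle.{u} 𝓘(ℝ, R3) (puncturedBall R)) (r : ℝ)
    (hr : 0 < r) (hrR : r < R) : HermitianLineBundle.{u} (𝓡 2) (Sphere r hr) :=
  L.pullback (Sphere.toPuncturedBall r hr hrR)

end HermitianLineBundle

end WeylSphere

end

open WeylSphere

/-!
Both statements compare the restrictions of a line bundle to two concentric spheres. Followed by the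
inclusion, the radial map from one sphere onto the other is homotopic, through radial maps, to the
inclusion of the first sphere, and pullbacks of a line bundle along homotopic maps from a compact
manifold are isomorphic
(`HermitianLineBundle.nonempty_isoOver_pullback`). For parameters that are close, an isomorphism is
obtained by averaging, with a partition of unity, the identifications of nearby fibers that local
trivializations provide; the average is the identity for equal parameters, hence invertible for
close ones, and connectedness of the parameter interval does the rest. The result is a bundle map,
covering the radial map, that is an isomorphism on every fiber.

Such a bundle map preserves the integral of the first Chern form, whatever the connections on the
two sides are (`HermitianLineBundle.IsoOver.chernIntegral_eq`). If `χ` and `χ'` are local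
connection forms and `g` is the local expression of the bundle map, covering `f`, then the one-form
`χ - f^*χ' - dg / g` does not depend on the local frames, so it is globally defined, and since
`dg / g` is closed its exterior derivative is the difference of the curvatures. In spherical
coordinates it becomes a smooth one-form on the plane that is periodic in the longitude and
vanishes on the tangent vectors of the lines that parametrize the poles, so by Stokes' theorem on
the coordinate rectangle the integral of its exterior derivative is zero (`integral_curl_eq_zero`).
Applied to the identity of a bundle this shows that the integral does not depend on the connection.
Connections exist because flat local ones can be averaged by a partition of unity
(`HermitianLineBundle.nonempty_connection`).
-/

noncomputable section

namespace WeylSphere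

/-! ### Differentials of maps from the plane -/

section Plane

variable {EB HB : Type*} [NormedAddCommGroup EB] [NormedSpace ℝ EB] [TopologicalSpace HB]
  {I : ModelWithCorners ℝ EB HB} {B : Type*} [TopologicalSpace B] [ChartedSpace HB B]
  {Φ : ℝ × ℝ → B}

theorem fderiv_comp_apply {h : B → ℂ} {x : ℝ × ℝ} (hΦ : ContMDiff 𝓘(ℝ, ℝ × ℝ) I ∞ Φ)
    (hh : MDifferentiableAt I 𝓘(ℝ, ℂ) h (Φ x)) (w : ℝ × ℝ) :
    fderiv ℝ (fun y => h (Φ y)) x w = mvfderiv I h (Φ x) (mfderiv 𝓘(ℝ, ℝ × ℝ) I Φ x w) := by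
  have := mfderiv_comp x hh (hΦ.mdifferentiable (by simp) x)
  rw [mfderiv_eq_fderiv] at this
  exact congr($this w)

/-- A map that is constant along a line has vanishing derivative in the direction of the line. -/
theorem mfderiv_apply_eq_zero (hΦ : ContMDiff 𝓘(ℝ, ℝ × ℝ) I ∞ Φ) {x w : ℝ × ℝ}
    (h : ∀ t : ℝ, Φ (x + t • w) = Φ x) : mfderiv 𝓘(ℝ, ℝ × ℝ) I Φ x w = 0 := by
  have hc : HasFDerivAt (fun t : ℝ => x + t • w)
      ((ContinuousLinearMap.id ℝ ℝ).smulRight w) 0 :=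
    ((hasFDerivAt_id (0 : ℝ)).smul_const w).const_add x
  have h1 := mfderiv_comp_apply_of_eq (I := 𝓘(ℝ, ℝ)) (y := x) (f := fun t : ℝ => x + t • w) (0 : ℝ)
    (hΦ.mdifferentiable (by simp) x) hc.differentiableAt.mdifferentiableAt (by simp) (1 : ℝ)
  rw [show Φ ∘ (fun t : ℝ => x + t • w) = fun _ => Φ x from funext h, mfderiv_const,
    mfderiv_eq_fderiv, hc.fderiv] at h1
  exact (congrArg (mfderiv 𝓘(ℝ, ℝ × ℝ) I Φ x) (one_smul ℝ w).symm).trans h1.symm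

end Plane

/-! ### Local frames and coordinates -/

namespace HermitianLineBundle

section Coordinates

variable {EB HB : Type*} [NormedAddCommGroup EB] [NormedSpace ℝ EB] [TopologicalSpace HB]
  {I : ModelWithCorners ℝ EB HB} {B : Type*} [TopologicalSpace B] [ChartedSpace HB B]
  {EM HM : Type*} [NormedAddCommGroup EM] [NormedSpace ℝ EM] [TopologicalSpace HM]
  {IM : ModelWithCorners ℝ EM HM} {M : Type*} [TopologicalSpace M] [ChartedSpace HM M]
  (L : HermitianLineBundle.{u} I B)

theorem contMDiffAt_complex_mul {f g : M → ℂ} {x : M} (hf : ContMDiffAt IM 𝓘(ℝ, ℂ) ∞ f x)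
    (hg : ContMDiffAt IM 𝓘(ℝ, ℂ) ∞ g x) : ContMDiffAt IM 𝓘(ℝ, ℂ) ∞ (fun y => f y * g y) x :=
  (contDiff_mul (𝕜 := ℝ) (𝔸 := ℂ) (n := ∞)).contMDiff.contMDiffAt.comp x (hf.prodMk_space hg)

/-- The domain of the preferred local trivialization of `L` at `p`. -/
def dom (p : B) : Set B := (trivializationAt ℂ L.Fiber p).baseSet

theorem isOpen_dom (p : B) : IsOpen (L.dom p) := (trivializationAt ℂ L.Fiber p).open_baseSet

theorem mem_dom_self (p : B) : p ∈ L.dom p := mem_baseSet_trivializationAt ℂ L.Fiber p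

theorem dom_mem_nhds {p x : B} (hx : x ∈ L.dom p) : L.dom p ∈ 𝓝 x := (L.isOpen_dom p).mem_nhds hx

/-- The coordinate of a vector of `L` with respect to the local frame around `p`. It is `0` off the
domain of the frame. -/
def coord (p x : B) : L.Fiber x →ₗ[ℂ] ℂ := (trivializationAt ℂ L.Fiber p).linearMapAt ℂ x

variable {L}

theorem coord_apply {p x : B} (hx : x ∈ L.dom p) (v : L.Fiber x) :
    L.coord p x v = (trivializationAt ℂ L.Fiber p ⟨x, v⟩).2 := by
  rw [coord, Trivialization.coe_linearMapAt_of_mem _ hx]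

theorem coord_frame {p x : B} (hx : x ∈ L.dom p) : L.coord p x (L.frame p x) = 1 := by
  rw [coord_apply hx, frame]
  exact congrArg Prod.snd ((trivializationAt ℂ L.Fiber p).apply_mk_symm hx 1)

theorem coord_smul_frame {p x : B} (hx : x ∈ L.dom p) (v : L.Fiber x) :
    L.coord p x v • L.frame p x = v := by
  have h := (trivializationAt ℂ L.Fiber p).symmₗ_linearMapAt (R := ℂ) hx
  have h2 : L.frame p x = (trivializationAt ℂ L.Fiber p).symmₗ ℂ x 1 := by
    rw [Trivialization.coe_symmₗ _ hx, frame]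
  rw [h2, ← map_smul, smul_eq_mul, mul_one]
  exact h v

theorem frame_ne_zero {p x : B} (hx : x ∈ L.dom p) : L.frame p x ≠ 0 := fun h => by
  simpa [h] using coord_frame hx

theorem coord_ne_zero {p x : B} (hx : x ∈ L.dom p) {v : L.Fiber x} (hv : v ≠ 0) :
    L.coord p x v ≠ 0 := fun h => hv (by rw [← coord_smul_frame hx v, h, zero_smul])

/-- A map into the total space is smooth if and only if its base point and its coordinate are. -/
theorem contMDiffAt_total_iff {f : M → L.Total} {x : M} {p : B} (hp : (f x).1 ∈ L.dom p) :
    ContMDiffAt IM (I.prod 𝓘(ℝ, ℂ)) ∞ f x ↔ ContMDiffAt IM I ∞ (fun y => (f y).1) x ∧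
      ContMDiffAt IM 𝓘(ℝ, ℂ) ∞ (fun y => L.coord p (f y).1 (f y).2) x := by
  rw [(trivializationAt ℂ L.Fiber p).contMDiffAt_iff ((Trivialization.mem_source _).2 hp)]
  refine and_congr_right fun h => Filter.EventuallyEq.contMDiffAt_iff ?_
  filter_upwards [h.continuousAt.preimage_mem_nhds (L.dom_mem_nhds hp)] with y hy
  exact (coord_apply hy _).symm

theorem contMDiffAt_frame {p x : B} (hx : x ∈ L.dom p) :
    ContMDiffAt I (I.prod 𝓘(ℝ, ℂ)) ∞ (fun y => (⟨y, L.frame p y⟩ : L.Total)) x := by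
  rw [contMDiffAt_total_iff hx]
  refine ⟨contMDiffAt_id, (contMDiffAt_const (c := (1 : ℂ))).congr_of_eventuallyEq ?_⟩
  filter_upwards [L.dom_mem_nhds hx] with y hy using coord_frame hy

/-- The transition functions between the local frames are smooth. -/
theorem contMDiffAt_coord_frame {p q x : B} (hp : x ∈ L.dom p) (hq : x ∈ L.dom q) :
    ContMDiffAt I 𝓘(ℝ, ℂ) ∞ (fun y => L.coord p y (L.frame q y)) x :=
  ((contMDiffAt_total_iff hp).1 (contMDiffAt_frame hq)).2

theorem mdifferentiableAt_frame {p x : B} (hx : x ∈ L.dom p) :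
    MDifferentiableAt I (I.prod 𝓘(ℝ, ℂ)) (fun y => (⟨y, L.frame p y⟩ : L.Total)) x :=
  (contMDiffAt_frame hx).mdifferentiableAt (by simp)

theorem mdifferentiableAt_coord {p x : B} (hp : x ∈ L.dom p) {σ : ∀ x, L.Fiber x}
    (hσ : MDifferentiableAt I (I.prod 𝓘(ℝ, ℂ)) (fun y => (⟨y, σ y⟩ : L.Total)) x) :
    MDifferentiableAt I 𝓘(ℝ, ℂ) (fun y => L.coord p y (σ y)) x := by
  refine (((trivializationAt ℂ L.Fiber p).mdifferentiableAt_section_iff I σ hp).1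
    hσ).congr_of_eventuallyEq ?_
  filter_upwards [L.dom_mem_nhds hp] with y hy using coord_apply hy _

theorem coord_smul_eventually {σ : ∀ x, L.Fiber x} {h : B → ℂ} {p x : B} (hx : x ∈ L.dom p) :
    (fun y => (trivializationAt ℂ L.Fiber p ⟨y, h y • σ y⟩).2) =ᶠ[𝓝 x]
      fun y => h y * (trivializationAt ℂ L.Fiber p ⟨y, σ y⟩).2 := by
  filter_upwards [L.dom_mem_nhds hx] with y hy
  rw [← coord_apply hy, ← coord_apply hy, map_smul, smul_eq_mul]

theorem mdifferentiableAt_complex_smul {σ : ∀ x, L.Fiber x} {h : B → ℂ} {x : B}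
    (hσ : MDifferentiableAt I (I.prod 𝓘(ℝ, ℂ)) (fun y => (⟨y, σ y⟩ : L.Total)) x)
    (hh : MDifferentiableAt I 𝓘(ℝ, ℂ) h x) :
    MDifferentiableAt I (I.prod 𝓘(ℝ, ℂ)) (fun y => (⟨y, h y • σ y⟩ : L.Total)) x := by
  rw [mdifferentiableAt_section] at hσ ⊢
  exact (hh.mul hσ).congr_of_eventuallyEq (coord_smul_eventually (L.mem_dom_self x))

end Coordinates

end HermitianLineBundle

/-! ### Bundle maps that are isomorphisms on fibers -/

namespace HermitianLineBundle

section Isomorphisms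

variable {EB HB : Type*} [NormedAddCommGroup EB] [NormedSpace ℝ EB] [TopologicalSpace HB]
  {I : ModelWithCorners ℝ EB HB} {B : Type*} [TopologicalSpace B] [ChartedSpace HB B]
  {EB' HB' : Type*} [NormedAddCommGroup EB'] [NormedSpace ℝ EB'] [TopologicalSpace HB']
  {I' : ModelWithCorners ℝ EB' HB'} {B' : Type*} [TopologicalSpace B'] [ChartedSpace HB' B']
  {EX HX : Type*} [NormedAddCommGroup EX] [NormedSpace ℝ EX] [TopologicalSpace HX]
  {IX : ModelWithCorners ℝ EX HX} {X : Type*} [TopologicalSpace X] [ChartedSpace HX X]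
  {L : HermitianLineBundle.{u} I B} {L' : HermitianLineBundle.{u} I' B'}
  {E : HermitianLineBundle.{u} IX X}

/-- A smooth bundle map from `L` to `L'` covering `f` that is a complex linear isomorphism on each
fiber. -/
structure IsoOver (f : B → B') (L : HermitianLineBundle.{u} I B)
    (L' : HermitianLineBundle.{u} I' B') where
  /-- The isomorphisms of the fibers. -/
  map : ∀ x, L.Fiber x ≃ₗ[ℂ] L'.Fiber (f x)
  contMDiff_map : ContMDiff (I.prod 𝓘(ℝ, ℂ)) (I'.prod 𝓘(ℝ, ℂ)) ∞
    (fun v : L.Total => (⟨f v.1, map v.1 v.2⟩ : L'.Total))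

namespace IsoOver

variable {f : B → B'}

/-- The factor by which a bundle map multiplies the coordinates with respect to the local frames
around `p` and `q`. -/
def factor (A : IsoOver f L L') (p : B) (q : B') (x : B) : ℂ :=
  L'.coord q (f x) (A.map x (L.frame p x))

theorem factor_ne_zero (A : IsoOver f L L') {p : B} {q : B'} {x : B} (hp : x ∈ L.dom p)
    (hq : f x ∈ L'.dom q) : A.factor p q x ≠ 0 :=
  coord_ne_zero hq ((A.map x).map_ne_zero_iff.2 (frame_ne_zero hp))

theorem contMDiffAt_factor (A : IsoOver f L L') {p : B} {q : B'} {x : B} (hp : x ∈ L.dom p)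
    (hq : f x ∈ L'.dom q) : ContMDiffAt I 𝓘(ℝ, ℂ) ∞ (A.factor p q) x :=
  ((contMDiffAt_total_iff (L := L') (p := q)
    (f := fun y => (⟨f y, A.map y (L.frame p y)⟩ : L'.Total)) hq).1
    ((A.contMDiff_map ⟨x, L.frame p x⟩).comp x (contMDiffAt_frame hp))).2

theorem contDiffAt_factor_comp (A : IsoOver f L L') {Φ : ℝ × ℝ → B}
    (hΦ : ContMDiff 𝓘(ℝ, ℝ × ℝ) I ∞ Φ) {p : B} {q : B'} {x : ℝ × ℝ}
    (hp : Φ x ∈ L.dom p) (hq : f (Φ x) ∈ L'.dom q) :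
    ContDiffAt ℝ ∞ (fun y => A.factor p q (Φ y)) x :=
  ((A.contMDiffAt_factor hp hq).comp x hΦ.contMDiffAt).contDiffAt

theorem coord_map (A : IsoOver f L L') {p : B} {q : B'} {x : B} (hp : x ∈ L.dom p)
    (v : L.Fiber x) : L'.coord q (f x) (A.map x v) = A.factor p q x * L.coord p x v := by
  conv_lhs => rw [← coord_smul_frame hp v, map_smul, map_smul, smul_eq_mul, mul_comm]
  rfl

/-- The identity of a line bundle. -/
def refl (L : HermitianLineBundle.{u} I B) : IsoOver id L L where
  map _ := LinearEquiv.refl ℂ _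
  contMDiff_map := contMDiff_id

/-- The canonical bundle map `(j ∘ σ)^*E = σ^*(j^*E) → j^*E`, which is the identity on fibers. -/
def pullbackComp (E : HermitianLineBundle.{u} IX X) (j : ContMDiffMap I' IX B' X ∞)
    (σ : ContMDiffMap I I' B B' ∞) :
    IsoOver σ (E.pullback (j.comp σ)) (E.pullback j) where
  map x := LinearEquiv.refl ℂ (E.Fiber (j (σ x)))
  contMDiff_map := by
    intro v
    rw [contMDiffAt_total_iff (L := E.pullback j) (p := σ v.1) ((E.pullback j).mem_dom_self _)]
    exact ⟨σ.contMDiff.contMDiffAt.comp v (contMDiffAt_proj _),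
      ((contMDiffAt_total_iff (L := E.pullback (j.comp σ)) (p := v.1)
        ((E.pullback (j.comp σ)).mem_dom_self _)).1 contMDiffAt_id).2⟩

/-- The composition of bundle maps. -/
def trans {EC HC : Type*} [NormedAddCommGroup EC] [NormedSpace ℝ EC] [TopologicalSpace HC]
    {IC : ModelWithCorners ℝ EC HC} {C : Type*} [TopologicalSpace C] [ChartedSpace HC C]
    {N : HermitianLineBundle.{u} IC C} {g : B' → C} (A : IsoOver f L L') (A' : IsoOver g L' N) :
    IsoOver (g ∘ f) L N where
  map x := (A.map x).trans (A'.map (f x))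
  contMDiff_map := A'.contMDiff_map.comp A.contMDiff_map

/-- The inverse of a bundle map is smooth, if the inverse of the map of the base spaces is. -/
theorem contMDiff_map_symm (A : IsoOver f L L') {g : B' → B} (hg : ContMDiff I' I ∞ g)
    (hgf : Function.LeftInverse g f) (hfg : Function.RightInverse g f)
    {ψ : L'.Total → L.Total} (hψ : ∀ v : L.Total, ψ ⟨f v.1, A.map v.1 v.2⟩ = v) :
    ContMDiff (I'.prod 𝓘(ℝ, ℂ)) (I.prod 𝓘(ℝ, ℂ)) ∞ ψ := by
  intro w
  have key : ∀ w : L'.Total, ∃ v : L.Total, (⟨f v.1, A.map v.1 v.2⟩ : L'.Total) = w := by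
    rintro ⟨y, w⟩
    obtain ⟨x, rfl⟩ := hfg.surjective y
    exact ⟨⟨x, (A.map x).symm w⟩, by simp⟩
  have hproj : ∀ w, (ψ w).1 = g w.1 := by
    intro w
    obtain ⟨v, rfl⟩ := key w
    rw [hψ, hgf]
  have h1 : (ψ w).1 ∈ L.dom (g w.1) := by rw [hproj]; exact L.mem_dom_self _
  have h2 : f (g w.1) ∈ L'.dom w.1 := by rw [hfg]; exact L'.mem_dom_self _
  have hgw : ContMDiffAt (I'.prod 𝓘(ℝ, ℂ)) I ∞ (fun w : L'.Total => g w.1) w :=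
    hg.contMDiffAt.comp w (contMDiffAt_proj _)
  rw [contMDiffAt_total_iff h1]
  refine ⟨by simpa only [hproj] using hgw, ?_⟩
  have h3 := (A.contMDiffAt_factor (L.mem_dom_self (g w.1)) h2)
  have h4 : ContMDiffAt (I'.prod 𝓘(ℝ, ℂ)) 𝓘(ℝ, ℂ) ∞
      (fun w' : L'.Total => A.factor (g w.1) w.1 (g w'.1)) w :=
    ContMDiffAt.comp w h3 hgw
  have h5 := ((contMDiffAt_total_iff (L := L') (p := w.1) (L'.mem_dom_self _)).1
    (contMDiffAt_id (x := w) (I := I'.prod 𝓘(ℝ, ℂ)) (n := ∞))).2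
  -- In coordinates, the inverse divides by the factor of `A`, which does not vanish.
  have h6 : ContMDiffAt (I'.prod 𝓘(ℝ, ℂ)) 𝓘(ℝ, ℂ) ∞
      (fun w' : L'.Total => (A.factor (g w.1) w.1 (g w'.1))⁻¹) w := by
    have : ContMDiffAt 𝓘(ℝ, ℂ) 𝓘(ℝ, ℂ) ∞ (fun z : ℂ => z⁻¹) (A.factor (g w.1) w.1 (g w.1)) :=
      (contDiffAt_inv ℝ (A.factor_ne_zero (L.mem_dom_self _) h2)).contMDiffAt
    exact this.comp w h4
  refine (contMDiffAt_complex_mul h6 h5).congr_of_eventuallyEq ?_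
  filter_upwards [hgw.continuousAt.preimage_mem_nhds (L.dom_mem_nhds (L.mem_dom_self (g w.1))),
    (contMDiff_proj (IB := I') (n := ∞) L'.Fiber).continuous.continuousAt.preimage_mem_nhds
      (L'.dom_mem_nhds (L'.mem_dom_self w.1))] with w' hw' hw''
  obtain ⟨v, rfl⟩ := key w'
  simp only [Set.mem_preimage, hgf v.1] at hw' hw''
  rw [hψ]
  simp only [id, hgf v.1, A.coord_map hw']
  rw [inv_mul_cancel_left₀ (A.factor_ne_zero hw' hw'')]

/-- A bundle map covering a diffeomorphism is an isomorphism of line bundles. -/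
theorem isomorphic {σ : Diffeomorph I I' B B' ∞} (A : IsoOver σ L L') : L.Isomorphic L' := by
  let Φ : L.Total → L'.Total := fun v => ⟨σ v.1, A.map v.1 v.2⟩
  have hΦ : Function.Bijective Φ := by
    constructor
    · rintro ⟨x, v⟩ ⟨y, w⟩ h
      obtain rfl : x = y := σ.injective (congrArg TotalSpace.proj h)
      simpa [Φ] using h
    · rintro ⟨y, w⟩
      obtain ⟨x, rfl⟩ := σ.surjective y
      exact ⟨⟨x, (A.map x).symm w⟩, by simp [Φ]⟩
  refine ⟨⟨Equiv.ofBijective Φ hΦ, A.contMDiff_map, ?_⟩, fun p => ⟨σ p, A.map p, fun v => rfl⟩⟩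
  exact A.contMDiff_map_symm σ.symm.contMDiff σ.symm_apply_apply σ.apply_symm_apply
    fun v => (Equiv.ofBijective Φ hΦ).symm_apply_apply v

/-- The inverse of an isomorphism covering the identity. -/
def symm {L₁ L₂ : HermitianLineBundle.{u} I B} (A : IsoOver id L₁ L₂) : IsoOver id L₂ L₁ where
  map x := (A.map x).symm
  contMDiff_map := A.contMDiff_map_symm contMDiff_id (fun _ => rfl) (fun _ => rfl) fun v => by
    simp

end IsoOver

end Isomorphisms

end HermitianLineBundle

/-! ### Homotopy invariance of pullbacks -/

/-- A compact manifold has a finite smooth partition of unity subordinate to a given family of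
neighborhoods of its points. -/
theorem exists_finite_partition {EB HB : Type*} [NormedAddCommGroup EB] [NormedSpace ℝ EB]
    [FiniteDimensional ℝ EB] [TopologicalSpace HB] (I : ModelWithCorners ℝ EB HB) {B : Type*}
    [TopologicalSpace B] [ChartedSpace HB B] [IsManifold I ∞ B] [CompactSpace B] [T2Space B]
    (U : B → Set B) (hU : ∀ x, IsOpen (U x)) (hmem : ∀ x, x ∈ U x) :
    ∃ (t : Finset B) (ρ : t → B → ℝ), (∀ i, ContMDiff I 𝓘(ℝ, ℝ) ∞ (ρ i)) ∧
      (∀ i, tsupport (ρ i) ⊆ U i) ∧ ∀ x, ∑ i, ρ i x = 1 := by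
  obtain ⟨t, ht⟩ := CompactSpace.elim_nhds_subcover U fun x => (hU x).mem_nhds (hmem x)
  obtain ⟨ρ, hρ⟩ := SmoothPartitionOfUnity.exists_isSubordinate I isClosed_univ
    (fun i : t => U i) (fun i => hU i) (by
      intro x _
      have hx : x ∈ ⋃ y ∈ t, U y := by rw [ht]; trivial
      simpa using hx)
  refine ⟨t, fun i => ρ i, fun i => (ρ i).contMDiff, fun i => hρ i, fun x => ?_⟩
  rw [← finsum_eq_sum_of_fintype]
  exact ρ.sum_eq_one (Set.mem_univ x)

namespace HermitianLineBundle

section Homotopy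

variable {EB HB : Type*} [NormedAddCommGroup EB] [NormedSpace ℝ EB] [TopologicalSpace HB]
  {I : ModelWithCorners ℝ EB HB} {B : Type*} [TopologicalSpace B] [ChartedSpace HB B]
  {EB' HB' : Type*} [NormedAddCommGroup EB'] [NormedSpace ℝ EB'] [TopologicalSpace HB']
  {I' : ModelWithCorners ℝ EB' HB'} {B' : Type*} [TopologicalSpace B'] [ChartedSpace HB' B']
  {EX HX : Type*} [NormedAddCommGroup EX] [NormedSpace ℝ EX] [TopologicalSpace HX]
  {IX : ModelWithCorners ℝ EX HX} {X : Type*} [TopologicalSpace X] [ChartedSpace HX X]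
  {L : HermitianLineBundle.{u} I B} {L' : HermitianLineBundle.{u} I' B'}

/-- Fibers being one-dimensional, a linear map is bijective as soon as its coefficient with respect
to the frames is nonzero. -/
theorem bijective_of_coord_ne_zero {p x : B} {q y : B'} (hx : x ∈ L.dom p) (hy : y ∈ L'.dom q)
    (A : L.Fiber x →ₗ[ℂ] L'.Fiber y) (h : L'.coord q y (A (L.frame p x)) ≠ 0) :
    Function.Bijective A := by
  have key : ∀ v, L'.coord q y (A v) = L.coord p x v * L'.coord q y (A (L.frame p x)) := by
    intro v
    conv_lhs => rw [← coord_smul_frame hx v, map_smul, map_smul, smul_eq_mul]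
  refine ⟨(injective_iff_map_eq_zero A).2 fun v hv => ?_, fun w => ?_⟩
  · have h1 := key v
    rw [hv, map_zero, eq_comm, mul_eq_zero, or_iff_left h] at h1
    rw [← coord_smul_frame hx v, h1, zero_smul]
  · refine ⟨(L'.coord q y w / L'.coord q y (A (L.frame p x))) • L.frame p x, ?_⟩
    rw [← coord_smul_frame hy (A _), key, map_smul, coord_frame hx, smul_eq_mul, mul_one,
      div_mul_cancel₀ _ h, coord_smul_frame hy]

variable (E : HermitianLineBundle.{u} IX X) {ι : Type*} [Fintype ι]

/-- The average, with weights `w i`, of the linear maps `E x → E y` that are the identity in the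
coordinates around `c i`. -/
def average (c : ι → X) (w : ι → ℝ) (x y : X) : E.Fiber x →ₗ[ℂ] E.Fiber y :=
  ∑ i, (w i : ℂ) • (E.coord (c i) x).smulRight (E.frame (c i) y)

variable {E}

theorem coord_average (c : ι → X) (w : ι → ℝ) (q x y : X) (v : E.Fiber x) :
    E.coord q y (E.average c w x y v) =
      ∑ i, (w i : ℂ) * (E.coord (c i) x v * E.coord q y (E.frame (c i) y)) := by
  simp [average]

/-- On a single fiber every local identification is the identity, and so is their average. -/
theorem average_self {c : ι → X} {w : ι → ℝ} (hw : ∑ i, w i = 1) {x : X}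
    (hx : ∀ i, w i ≠ 0 → x ∈ E.dom (c i)) (v : E.Fiber x) : E.average c w x x v = v := by
  have h1 : ∀ i, ((w i : ℂ) • (E.coord (c i) x).smulRight (E.frame (c i) x)) v = (w i : ℂ) • v := by
    intro i
    by_cases hi : w i = 0
    · simp [hi]
    · simp [coord_smul_frame (hx i hi)]
  rw [average, LinearMap.sum_apply, Finset.sum_congr rfl fun i _ => h1 i, ← Finset.sum_smul,
    ← Complex.ofReal_sum, hw, Complex.ofReal_one, one_smul]

variable [FiniteDimensional ℝ EB] [IsManifold I ∞ B] [CompactSpace B] [T2Space B]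
  {T : Type*} [TopologicalSpace T]

/-- Pullbacks along neighboring members of a homotopy are isomorphic: the identifications of nearby
fibers given by local trivializations are averaged by a partition of unity, and near the given
member the average is still invertible. -/
theorem eventually_nonempty_isoOver_pullback (F : T → ContMDiffMap I IX B X ∞)
    (hF : Continuous fun z : T × B => F z.1 z.2) (s : T) :
    ∀ᶠ t in 𝓝 s, Nonempty (IsoOver id (E.pullback (F s)) (E.pullback (F t))) := by
  obtain ⟨J, ρ, hρ, hsub, hsum⟩ := exists_finite_partition I (fun x => F s ⁻¹' E.dom (F s x))
    (fun x => (E.isOpen_dom _).preimage (F s).contMDiff.continuous) fun x => E.mem_dom_self _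
  have hFt : ∀ t, ContMDiff I IX ∞ (F t) := fun t => (F t).contMDiff
  have hrho : ∀ i, ContMDiff I 𝓘(ℝ, ℂ) ∞ (fun x => (ρ i x : ℂ)) := fun i =>
    (Complex.ofRealCLM.contDiff (n := ∞)).contMDiff.comp (hρ i)
  let c : J → X := fun i => F s i
  let A : ∀ (t : T) (x : B), E.Fiber (F s x) →ₗ[ℂ] E.Fiber (F t x) := fun t x =>
    E.average c (fun i => ρ i x) (F s x) (F t x)
  -- For `t` near `s`, uniformly in `x` by compactness, `F t` maps the support of `ρ i` into the
  -- domain of the frame around `c i`, which makes `A t` smooth, and the average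
  -- `A t x` is invertible.
  have h1 : ∀ᶠ t in 𝓝 s, ∀ x ∈ (Set.univ : Set B),
      (∀ i, x ∈ tsupport (ρ i) → F t x ∈ E.dom (c i)) ∧ Function.Bijective (A t x) := by
    refine isCompact_univ.eventually_forall_of_forall_eventually fun x _ => ?_
    have hc : ∀ {q : X}, F s x ∈ E.dom q → ∀ᶠ z : T × B in 𝓝 (s, x), F z.1 z.2 ∈ E.dom q :=
      fun hq => hF.continuousAt.preimage_mem_nhds (x := (s, x)) (E.dom_mem_nhds hq)
    have hc' : ∀ {q : X}, F s x ∈ E.dom q → ∀ᶠ z : T × B in 𝓝 (s, x), F s z.2 ∈ E.dom q :=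
      fun hq => ((hFt s).continuous.comp continuous_snd).continuousAt.preimage_mem_nhds
        (x := (s, x)) (E.dom_mem_nhds hq)
    refine Filter.Eventually.and (Filter.eventually_all.2 fun i => ?_) ?_
    · by_cases hi : x ∈ tsupport (ρ i)
      · filter_upwards [hc (hsub i hi)] with z hz _ using hz
      · have h2 : ∀ᶠ z : T × B in 𝓝 (s, x), z.2 ∈ (tsupport (ρ i))ᶜ :=
          continuous_snd.continuousAt.preimage_mem_nhds (x := (s, x))
            ((isClosed_tsupport _).isOpen_compl.mem_nhds hi)
        filter_upwards [h2] with z hz hz' using absurd hz' hz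
    · -- The coefficient of `A t y` is continuous in `(t, y)`, and it is `1` at `(s, x)`.
      have hq := E.mem_dom_self (F s x)
      have hcont : ContinuousAt (fun z : T × B => ∑ i, (ρ i z.2 : ℂ) *
          (E.coord (c i) (F s z.2) (E.frame (F s x) (F s z.2)) *
            E.coord (F s x) (F z.1 z.2) (E.frame (c i) (F z.1 z.2)))) (s, x) := by
        refine tendsto_finsetSum _ fun i _ => ?_
        by_cases hi : x ∈ tsupport (ρ i)
        · refine ContinuousAt.mul ?_ (ContinuousAt.mul ?_ ?_)
          · exact ((hrho i).continuous.comp continuous_snd).continuousAt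
          · exact ContinuousAt.comp (x := ((s, x) : T × B)) (f := fun z : T × B => F s z.2)
              (contMDiffAt_coord_frame (L := E) (hsub i hi) hq).continuousAt
              ((hFt s).continuous.comp continuous_snd).continuousAt
          · exact ContinuousAt.comp (x := ((s, x) : T × B)) (f := fun z : T × B => F z.1 z.2)
              (contMDiffAt_coord_frame (L := E) hq (hsub i hi)).continuousAt hF.continuousAt
        · have h2 : ∀ᶠ z : T × B in 𝓝 (s, x), z.2 ∈ (tsupport (ρ i))ᶜ :=
            continuous_snd.continuousAt.preimage_mem_nhds (x := (s, x))
              ((isClosed_tsupport _).isOpen_compl.mem_nhds hi)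
          have h3 : ContinuousAt (fun _ : T × B => (0 : ℂ)) (s, x) := continuousAt_const
          refine h3.congr ?_
          filter_upwards [h2] with z hz
          rw [image_eq_zero_of_notMem_tsupport hz, Complex.ofReal_zero, zero_mul]
      have hne := hcont.eventually_ne (y := 0) (by
        rw [← coord_average c (fun i => ρ i x) (F s x) (F s x) (F s x), average_self (hsum x)
          fun i hi => hsub i (subset_tsupport _ hi), coord_frame hq]
        exact one_ne_zero)
      filter_upwards [hne, hc hq, hc' hq] with z hz h3 h4
      refine bijective_of_coord_ne_zero h4 h3 _ ?_
      rw [coord_average]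
      exact hz
  filter_upwards [h1] with t ht
  refine ⟨⟨fun x => LinearEquiv.ofBijective (A t x) (ht x trivial).2, fun v => ?_⟩⟩
  rw [contMDiffAt_total_iff (L := E.pullback (F t)) (p := v.1) ((E.pullback (F t)).mem_dom_self _)]
  have hv : ContMDiffAt (I.prod 𝓘(ℝ, ℂ)) I ∞ (fun v : (E.pullback (F s)).Total => v.1) v :=
    contMDiffAt_proj _
  refine ⟨hv, ?_⟩
  have h2 : ∀ w : (E.pullback (F s)).Total,
      (E.pullback (F t)).coord v.1 w.1 (A t w.1 w.2) = ∑ i, (ρ i w.1 : ℂ) *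
        ((E.pullback (F s)).coord i w.1 w.2 *
          E.coord (F t v.1) (F t w.1) (E.frame (c i) (F t w.1))) :=
    fun w => coord_average c (fun i => ρ i w.1) (F t v.1) (F s w.1) (F t w.1) w.2
  refine (ContMDiffAt.congr_of_eventuallyEq ?_ (Filter.Eventually.of_forall h2))
  refine contMDiffAt_finsetSum fun i _ => ?_
  by_cases hi : v.1 ∈ tsupport (ρ i)
  · refine contMDiffAt_complex_mul ((hrho i).contMDiffAt.comp v hv)
      (contMDiffAt_complex_mul ?_ ?_)
    · exact ((contMDiffAt_total_iff (L := E.pullback (F s)) (p := (i : B)) (hsub i hi)).1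
        contMDiffAt_id).2
    · exact ContMDiffAt.comp (g := fun y => E.coord (F t v.1) y (E.frame (c i) y)) v
        (contMDiffAt_coord_frame (L := E) (E.mem_dom_self _) ((ht v.1 trivial).1 i hi))
        ((hFt t).contMDiffAt.comp v hv)
  · refine (contMDiffAt_const (c := (0 : ℂ))).congr_of_eventuallyEq ?_
    filter_upwards [hv.continuousAt.preimage_mem_nhds
      ((isClosed_tsupport _).isOpen_compl.mem_nhds hi)] with w hw
    rw [image_eq_zero_of_notMem_tsupport hw, Complex.ofReal_zero, zero_mul]

/-- Homotopy invariance of the pullback: the isomorphism class of the pullback is locally constant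
in the parameter of the homotopy, hence constant on a connected parameter space. -/
theorem nonempty_isoOver_pullback [PreconnectedSpace T] (F : T → ContMDiffMap I IX B X ∞)
    (hF : Continuous fun z : T × B => F z.1 z.2) (s t : T) :
    Nonempty (IsoOver id (E.pullback (F s)) (E.pullback (F t))) := by
  let P : T → T → Prop := fun s t => Nonempty (IsoOver id (E.pullback (F s)) (E.pullback (F t)))
  have : Std.Symm P := ⟨fun _ _ ⟨A⟩ => ⟨A.symm⟩⟩
  have : IsTrans T P := ⟨fun _ _ _ ⟨A⟩ ⟨A'⟩ => ⟨A.trans A'⟩⟩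
  exact PreconnectedSpace.induction₂ P (eventually_nonempty_isoOver_pullback F hF) this s t

end Homotopy

end HermitianLineBundle

/-! ### One-forms on the plane -/

section LogForm

/-- The exterior derivative of a one-form on the plane, evaluated on the coordinate vectors. -/
def curl (α : ℝ × ℝ → ℝ × ℝ →L[ℝ] ℂ) (x : ℝ × ℝ) : ℂ :=
  fderiv ℝ α x (1, 0) (0, 1) - fderiv ℝ α x (0, 1) (1, 0)

/-- The logarithmic differential `dk / k`. -/
def logForm (k : ℝ × ℝ → ℂ) (x : ℝ × ℝ) : ℝ × ℝ →L[ℝ] ℂ := (k x)⁻¹ • fderiv ℝ k x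

theorem curl_congr {α η : ℝ × ℝ → ℝ × ℝ →L[ℝ] ℂ} {x : ℝ × ℝ} (h : α =ᶠ[𝓝 x] η) :
    curl α x = curl η x := by
  rw [curl, curl, h.fderiv_eq]

theorem curl_add {α η : ℝ × ℝ → ℝ × ℝ →L[ℝ] ℂ} {x : ℝ × ℝ} (hα : DifferentiableAt ℝ α x)
    (hη : DifferentiableAt ℝ η x) : curl (fun y => α y + η y) x = curl α x + curl η x := by
  rw [curl, curl, curl, fderiv_fun_add hα hη]
  simp only [add_apply]
  ring

theorem curl_sub {α η : ℝ × ℝ → ℝ × ℝ →L[ℝ] ℂ} {x : ℝ × ℝ} (hα : DifferentiableAt ℝ α x)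
    (hη : DifferentiableAt ℝ η x) : curl (fun y => α y - η y) x = curl α x - curl η x := by
  rw [curl, curl, curl, fderiv_fun_sub hα hη]
  simp only [sub_apply]
  ring

theorem contDiffAt_logForm {k : ℝ × ℝ → ℂ} {x : ℝ × ℝ} (hk : ContDiffAt ℝ ∞ k x) (h0 : k x ≠ 0) :
    ContDiffAt ℝ ∞ (logForm k) x :=
  (hk.inv h0).smul (hk.fderiv_right (m := ∞) le_rfl)

/-- Logarithmic differentials are closed, by the symmetry of second derivatives. -/
theorem curl_logForm {k : ℝ × ℝ → ℂ} {x : ℝ × ℝ} (hk : ContDiffAt ℝ ∞ k x) (h0 : k x ≠ 0) :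
    curl (logForm k) x = 0 := by
  have hsymm : IsSymmSndFDerivAt ℝ k x := hk.isSymmSndFDerivAt (n := ∞) (by
    rw [minSmoothness_of_isRCLikeNormedField]
    exact WithTop.coe_le_coe.2 le_top)
  have h1 : DifferentiableAt ℝ (fun y => (k y)⁻¹) x := (hk.inv h0).differentiableAt (by simp)
  have h2 : DifferentiableAt ℝ (fderiv ℝ k) x :=
    (hk.fderiv_right (m := ∞) le_rfl).differentiableAt (by simp)
  have h3 : HasFDerivAt (fun y => (k y)⁻¹) (-((k x ^ 2)⁻¹ • fderiv ℝ k x)) x := by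
    have := ((hasDerivAt_inv h0).hasFDerivAt.restrictScalars ℝ).comp x
      (hk.differentiableAt (by simp)).hasFDerivAt
    convert! this using 1
    ext <;> simp [mul_comm]
  have h4 := h3.smul h2.hasFDerivAt
  have h5 : fderiv ℝ (logForm k) x = _ := h4.fderiv
  rw [curl, h5]
  simp only [add_apply, smul_apply, smul_eq_mul, neg_apply, ContinuousLinearMap.smulRight_apply]
  rw [hsymm.eq (1, 0) (0, 1)]
  ring

theorem logForm_mul {k l : ℝ × ℝ → ℂ} {x : ℝ × ℝ} (hk : DifferentiableAt ℝ k x)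
    (hl : DifferentiableAt ℝ l x) (hk0 : k x ≠ 0) (hl0 : l x ≠ 0) :
    logForm (fun y => k y * l y) x = logForm k x + logForm l x := by
  have h : fderiv ℝ (fun y => k y * l y) x = _ := (hk.hasFDerivAt.mul hl.hasFDerivAt).fderiv
  ext <;> simp only [logForm, h] <;> simp <;> field_simp <;> ring

theorem logForm_congr {k l : ℝ × ℝ → ℂ} {x : ℝ × ℝ} (h : k =ᶠ[𝓝 x] l) :
    logForm k x = logForm l x := by
  rw [logForm, logForm, h.fderiv_eq, h.eq_of_nhds]

/-- Stokes' theorem for spherical coordinates: a smooth one-form on the coordinate plane that is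
periodic in the longitude, and vanishes along the lines that parametrize the poles, has an exact
differential with vanishing integral. -/
theorem integral_curl_eq_zero {α : ℝ × ℝ → ℝ × ℝ →L[ℝ] ℂ} (hα : ContDiff ℝ ∞ α)
    (hper : ∀ u v, α (u, v + 2 * Real.pi) = α (u, v)) (h0 : ∀ v, α (0, v) (0, 1) = 0)
    (hpi : ∀ v, α (Real.pi, v) (0, 1) = 0) :
    ∫ u in (0 : ℝ)..Real.pi, ∫ v in (0 : ℝ)..(2 * Real.pi), curl α (u, v) = 0 := by
  have ha : ∀ w x, HasFDerivAt (fun y => α y w)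
      ((ContinuousLinearMap.apply ℝ ℂ w).comp (fderiv ℝ α x)) x := fun w x =>
    (ContinuousLinearMap.apply ℝ ℂ w).hasFDerivAt.comp x
      (hα.differentiable (by simp)).differentiableAt.hasFDerivAt
  have hcont : ∀ w w', Continuous fun x => fderiv ℝ α x w w' := fun w w' =>
    ((hα.continuous_fderiv (by simp)).clm_apply continuous_const).clm_apply continuous_const
  have key := MeasureTheory.integral2_divergence_prod_of_hasFDerivAt_off_countable
    (fun y => α y (0, 1)) (fun y => -α y (1, 0))
    (fun x => (ContinuousLinearMap.apply ℝ ℂ (0, 1)).comp (fderiv ℝ α x))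
    (fun x => -(ContinuousLinearMap.apply ℝ ℂ (1, 0)).comp (fderiv ℝ α x))
    0 0 Real.pi (2 * Real.pi) ∅ Set.countable_empty
    (hα.continuous.clm_apply continuous_const).continuousOn
    (hα.continuous.clm_apply continuous_const).neg.continuousOn
    (fun x _ => ha _ x) (fun x _ => (ha _ x).neg) (by
      refine ContinuousOn.integrableOn_compact
        (isCompact_uIcc.prod isCompact_uIcc) (Continuous.continuousOn ?_)
      exact (hcont _ _).add (hcont _ _).neg)
  have hp : ∀ u, α (u, 2 * Real.pi) = α (u, 0) := fun u => by simpa using hper u 0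
  simp only [h0, hpi, hp] at key
  simpa [curl, sub_eq_add_neg] using key

end LogForm

/-! ### Connection forms and their curvature -/

namespace HermitianLineBundle

namespace Connection

variable {EB HB : Type*} [NormedAddCommGroup EB] [NormedSpace ℝ EB] [TopologicalSpace HB]
  {I : ModelWithCorners ℝ EB HB} {B : Type*} [TopologicalSpace B] [ChartedSpace HB B]
  [IsManifold I ∞ B] {L : HermitianLineBundle.{u} I B}

theorem cov_congr (D : L.Connection) {σ τ : ∀ x, L.Fiber x} {x : B}
    (hσ : MDifferentiableAt I (I.prod 𝓘(ℝ, ℂ)) (fun y => (⟨y, σ y⟩ : L.Total)) x)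
    (hτ : MDifferentiableAt I (I.prod 𝓘(ℝ, ℂ)) (fun y => (⟨y, τ y⟩ : L.Total)) x)
    (h : ∀ᶠ y in 𝓝 x, σ y = τ y) : D.cov σ x = D.cov τ x :=
  D.cov.isCovariantDerivativeOnUniv.congr_of_eventuallyEq hσ hτ Filter.univ_mem h

/-- The Leibniz rule for complex-valued functions. It follows from the rule for real-valued ones,
applied to the real and the imaginary part, and the complex linearity of the connection. -/
theorem cov_complex_smul (D : L.Connection) {σ : ∀ x, L.Fiber x} {h : B → ℂ} {x : B}
    (hσ : MDifferentiableAt I (I.prod 𝓘(ℝ, ℂ)) (fun y => (⟨y, σ y⟩ : L.Total)) x)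
    (hh : MDifferentiableAt I 𝓘(ℝ, ℂ) h x) (X : TangentSpace I x) :
    D.cov (fun y => h y • σ y) x X = mvfderiv I h x X • σ x + h x • D.cov σ x X := by
  have hre : MDifferentiableAt I 𝓘(ℝ, ℝ) (fun y => (h y).re) x :=
    Complex.reCLM.differentiableAt.mdifferentiableAt.comp x hh
  have him : MDifferentiableAt I 𝓘(ℝ, ℝ) (fun y => (h y).im) x :=
    Complex.imCLM.differentiableAt.mdifferentiableAt.comp x hh
  have hre' : mvfderiv I (fun y => (h y).re) x X = (mvfderiv I h x X).re := by
    have := mfderiv_comp x (Complex.reCLM.differentiableAt (x := h x)).mdifferentiableAt hh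
    rw [mfderiv_eq_fderiv, Complex.reCLM.fderiv] at this
    exact congr($this X)
  have him' : mvfderiv I (fun y => (h y).im) x X = (mvfderiv I h x X).im := by
    have := mfderiv_comp x (Complex.imCLM.differentiableAt (x := h x)).mdifferentiableAt hh
    rw [mfderiv_eq_fderiv, Complex.imCLM.fderiv] at this
    exact congr($this X)
  have hσi := mdifferentiableAt_complex_smul hσ (h := fun _ => Complex.I) mdifferentiableAt_const
  have h1 : (fun y => h y • σ y) = (fun y => (h y).re) • σ +
      (fun y => (h y).im) • fun y => Complex.I • σ y := by
    funext y
    conv_lhs => rw [← Complex.re_add_im (h y), add_smul, mul_smul]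
    rfl
  have hcov := D.cov.isCovariantDerivativeOnUniv
  rw [h1, hcov.add (hre.smul_section hσ) (him.smul_section hσi), hcov.leibniz hσ hre,
    hcov.leibniz hσi him]
  simp only [add_apply, smul_apply, ContinuousLinearMap.smulRight_apply, hre', him',
    D.cov_smul _ _ _ hσ]
  conv_rhs => rw [← Complex.re_add_im (h x), ← Complex.re_add_im (mvfderiv I h x X)]
  simp only [add_smul, mul_smul, Complex.coe_smul]
  abel

theorem form_apply (D : L.Connection) {p x : B} (hx : x ∈ L.dom p) (X : TangentSpace I x) :
    D.form p x X = L.coord p x (D.cov (L.frame p) x X) := by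
  rw [coord_apply hx]
  exact congrFun (Trivialization.coe_linearMapAt_of_mem (R := ℝ) _ hx) _

/-- The change of the connection form under a change of the local frame. -/
theorem form_gauge (D : L.Connection) {p q x : B} (hp : x ∈ L.dom p) (hq : x ∈ L.dom q)
    (X : TangentSpace I x) :
    D.form q x X = D.form p x X + (L.coord p x (L.frame q x))⁻¹ *
      mvfderiv I (fun y => L.coord p y (L.frame q y)) x X := by
  have hh : MDifferentiableAt I 𝓘(ℝ, ℂ) (fun y => L.coord p y (L.frame q y)) x :=
    (contMDiffAt_coord_frame hp hq).mdifferentiableAt (by simp)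
  have h1 : D.cov (L.frame q) x = D.cov (fun y => L.coord p y (L.frame q y) • L.frame p y) x := by
    refine D.cov_congr (mdifferentiableAt_frame hq)
      (mdifferentiableAt_complex_smul (mdifferentiableAt_frame hp) hh) ?_
    filter_upwards [L.dom_mem_nhds hp] with y hy using (coord_smul_frame hy _).symm
  have h0 : L.coord p x (L.frame q x) ≠ 0 := coord_ne_zero hp (frame_ne_zero hq)
  have h2 : ∀ v : L.Fiber x, L.coord q x v = (L.coord p x (L.frame q x))⁻¹ * L.coord p x v := by
    intro v
    conv_rhs => rw [← coord_smul_frame hq v, map_smul, smul_eq_mul]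
    field_simp
  rw [form_apply D hq, h1, D.cov_complex_smul (mdifferentiableAt_frame hp) hh, h2, map_add,
    map_smul, map_smul, coord_frame hp, form_apply D hp]
  simp only [smul_eq_mul]
  field_simp
  ring

section Pullback

variable {Φ : ℝ × ℝ → B}

theorem pullbackForm_gauge (D : L.Connection) (hΦ : ContMDiff 𝓘(ℝ, ℝ × ℝ) I ∞ Φ) {p q : B}
    {x : ℝ × ℝ} (hp : Φ x ∈ L.dom p) (hq : Φ x ∈ L.dom q) :
    D.pullbackForm Φ q x = D.pullbackForm Φ p x +
      logForm (fun y => L.coord p (Φ y) (L.frame q (Φ y))) x := by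
  refine ContinuousLinearMap.ext fun w => ?_
  refine (D.form_gauge hp hq _).trans ?_
  exact congrArg (fun z => D.pullbackForm Φ p x w + (L.coord p (Φ x) (L.frame q (Φ x)))⁻¹ * z)
    (fderiv_comp_apply hΦ ((contMDiffAt_coord_frame hp hq).mdifferentiableAt (by simp)) w).symm

variable [FiniteDimensional ℝ EB] [T2Space B] [SigmaCompactSpace B]

/-- A local frame agrees near a given point with a global smooth section. -/
theorem exists_contMDiff_eventually_eq_frame {p x : B} (hx : x ∈ L.dom p) :
    ∃ σ : ∀ y, L.Fiber y, ContMDiff I (I.prod 𝓘(ℝ, ℂ)) ∞ (fun y => (⟨y, σ y⟩ : L.Total)) ∧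
      ∀ᶠ y in 𝓝 x, σ y = L.frame p y := by
  have : LocallyCompactSpace HB := I.locallyCompactSpace
  have : LocallyCompactSpace B := ChartedSpace.locallyCompactSpace HB B
  obtain ⟨ψ, h0, h1, -⟩ := exists_contMDiffMap_zero_one_nhds_of_isClosed (n := ⊤) I
    (L.isOpen_dom p).isClosed_compl (isClosed_singleton (x := x))
    (Set.disjoint_singleton_right.2 fun h => h hx)
  refine ⟨(ψ : B → ℝ) • L.frame p, ?_, ?_⟩
  · refine ContMDiffOn.smul_section_of_tsupport (u := L.dom p) ψ.contMDiff.contMDiffOn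
      (L.isOpen_dom p) ?_ fun y hy => (contMDiffAt_frame hy).contMDiffWithinAt
    intro y hy
    by_contra hy'
    refine (notMem_tsupport_iff_eventuallyEq.2 ?_) hy
    exact (eventually_nhdsSet_iff_forall.1 h0) y hy'
  · rw [nhdsSet_singleton] at h1
    filter_upwards [h1] with y hy
    simp [hy]

/-- The pullbacks of the local connection forms are smooth. Smoothness of a connection is a
condition on global sections, so the local frame is first replaced by a global section that agrees
with it near the given point. -/
theorem contDiffAt_pullbackForm (D : L.Connection) (hΦ : ContMDiff 𝓘(ℝ, ℝ × ℝ) I ∞ Φ) {p : B}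
    {x : ℝ × ℝ} (hp : Φ x ∈ L.dom p) : ContDiffAt ℝ ∞ (D.pullbackForm Φ p) x := by
  obtain ⟨σ, hσ, hσp⟩ := exists_contMDiff_eventually_eq_frame hp
  have hcov := (D.contMDiff_cov.contMDiff.contMDiff (σ := σ) hσ.contMDiffOn)
  rw [contMDiffOn_univ] at hcov
  have key : ∀ w : ℝ × ℝ, ContDiffAt ℝ ∞ (fun y => D.pullbackForm Φ p y w) x := by
    intro w
    have hw : ContMDiff 𝓘(ℝ, ℝ × ℝ) (𝓘(ℝ, ℝ × ℝ).prod 𝓘(ℝ, ℝ × ℝ)) ∞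
        (fun y => (⟨y, w⟩ : TangentBundle 𝓘(ℝ, ℝ × ℝ) (ℝ × ℝ))) :=
      contMDiff_vectorSpace_iff_contDiff.2 contDiff_const
    have ht : ContMDiff 𝓘(ℝ, ℝ × ℝ) (I.prod 𝓘(ℝ, EB)) ∞ (fun y =>
        (⟨Φ y, mfderiv 𝓘(ℝ, ℝ × ℝ) I Φ y w⟩ : TangentBundle I B)) :=
      (hΦ.contMDiff_tangentMap (m := ∞) le_rfl).comp hw
    have h2 : ContMDiffAt 𝓘(ℝ, ℝ × ℝ) (I.prod 𝓘(ℝ, ℂ)) ∞ (fun y =>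
        (⟨Φ y, D.cov σ (Φ y) (mfderiv 𝓘(ℝ, ℝ × ℝ) I Φ y w)⟩ : L.Total)) x :=
      (hcov.comp hΦ).contMDiffAt.clm_bundle_apply ht.contMDiffAt
    rw [contMDiffAt_total_iff hp] at h2
    refine h2.2.contDiffAt.congr_of_eventuallyEq ?_
    have h3 := hΦ.continuous.continuousAt.eventually (hσp.eventually_nhds)
    filter_upwards [h3, hΦ.continuous.continuousAt.preimage_mem_nhds (L.dom_mem_nhds hp)]
      with y hy hy'
    have h4 : D.cov (L.frame p) (Φ y) = D.cov σ (Φ y) :=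
      D.cov_congr (mdifferentiableAt_frame hy') (hσ.mdifferentiable (by simp) _)
        (hy.mono fun _ h => h.symm)
    rw [← h4]
    exact D.form_apply hy' _
  -- A one-form on the plane is determined by its two components.
  have h5 : D.pullbackForm Φ p = fun y =>
      (ContinuousLinearMap.fst ℝ ℝ ℝ).smulRight (D.pullbackForm Φ p y (1, 0)) +
      (ContinuousLinearMap.snd ℝ ℝ ℝ).smulRight (D.pullbackForm Φ p y (0, 1)) := by
    funext y
    ext <;> simp
  rw [h5]
  exact (contDiffAt_const.smulRight (key _)).add (contDiffAt_const.smulRight (key _))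

/-- The curvature can be computed from the connection form in any local frame, since a change of the
frame adds a closed form. In particular the frame can be kept fixed near a point, whereas the
definition of the curvature uses the frame around the point itself. -/
theorem curvatureAlong_eq_curl (D : L.Connection) (hΦ : ContMDiff 𝓘(ℝ, ℝ × ℝ) I ∞ Φ) {p : B}
    {x : ℝ × ℝ} (hp : Φ x ∈ L.dom p) :
    D.curvatureAlong Φ x = curl (D.pullbackForm Φ p) x := by
  have hq := L.mem_dom_self (Φ x)
  have hk : ContDiffAt ℝ ∞ (fun y => L.coord p (Φ y) (L.frame (Φ x) (Φ y))) x :=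
    (ContMDiffAt.comp x (contMDiffAt_coord_frame hp hq) hΦ.contMDiffAt).contDiffAt
  have h0 : L.coord p (Φ x) (L.frame (Φ x) (Φ x)) ≠ 0 := coord_ne_zero hp (frame_ne_zero hq)
  have h1 : D.curvatureAlong Φ x = curl (D.pullbackForm Φ (Φ x)) x := rfl
  have h2 : D.pullbackForm Φ (Φ x) =ᶠ[𝓝 x] fun y => D.pullbackForm Φ p y +
      logForm (fun z => L.coord p (Φ z) (L.frame (Φ x) (Φ z))) y := by
    filter_upwards [hΦ.continuous.continuousAt.preimage_mem_nhds (L.dom_mem_nhds hp),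
      hΦ.continuous.continuousAt.preimage_mem_nhds (L.dom_mem_nhds hq)] with y hy hy'
    exact D.pullbackForm_gauge hΦ hy hy'
  rw [h1, curl_congr h2, curl_add ((D.contDiffAt_pullbackForm hΦ hp).differentiableAt (by simp))
    ((contDiffAt_logForm hk h0).differentiableAt (by simp)), curl_logForm hk h0, add_zero]

theorem continuous_curvatureAlong (D : L.Connection) (hΦ : ContMDiff 𝓘(ℝ, ℝ × ℝ) I ∞ Φ) :
    Continuous (D.curvatureAlong Φ) := by
  refine continuous_iff_continuousAt.2 fun x => ?_
  have h1 : ContinuousAt (fderiv ℝ (D.pullbackForm Φ (Φ x))) x :=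
    ((D.contDiffAt_pullbackForm hΦ (L.mem_dom_self _)).fderiv_right (m := ∞) le_rfl).continuousAt
  have h2 : ContinuousAt (curl (D.pullbackForm Φ (Φ x))) x :=
    ((h1.clm_apply continuousAt_const).clm_apply continuousAt_const).sub
      ((h1.clm_apply continuousAt_const).clm_apply continuousAt_const)
  refine h2.congr ?_
  filter_upwards [hΦ.continuous.continuousAt.preimage_mem_nhds
    (L.dom_mem_nhds (L.mem_dom_self (Φ x)))] with y hy
  exact (D.curvatureAlong_eq_curl hΦ hy).symm

end Pullback

end Connection

end HermitianLineBundle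

/-! ### The difference of two connections along a bundle map -/

namespace HermitianLineBundle

section Difference

variable {EB HB : Type*} [NormedAddCommGroup EB] [NormedSpace ℝ EB] [TopologicalSpace HB]
  {I : ModelWithCorners ℝ EB HB} {B : Type*} [TopologicalSpace B] [ChartedSpace HB B]
  [IsManifold I ∞ B] {L : HermitianLineBundle.{u} I B}
  {EB' HB' : Type*} [NormedAddCommGroup EB'] [NormedSpace ℝ EB'] [TopologicalSpace HB']
  {I' : ModelWithCorners ℝ EB' HB'} {B' : Type*} [TopologicalSpace B'] [ChartedSpace HB' B']
  [IsManifold I' ∞ B'] {L' : HermitianLineBundle.{u} I' B'}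
  {Φ : ℝ × ℝ → B} {f : B → B'}

namespace Connection

theorem pullbackForm_periodic (D : L.Connection) (hΦ : ContMDiff 𝓘(ℝ, ℝ × ℝ) I ∞ Φ) {T : ℝ × ℝ}
    (h : ∀ x, Φ (x + T) = Φ x) (p : B) (x : ℝ × ℝ) :
    D.pullbackForm Φ p (x + T) = D.pullbackForm Φ p x := by
  have h1 : D.pullbackForm (fun y => Φ (y + T)) p x = D.pullbackForm Φ p (x + T) := by
    refine ContinuousLinearMap.ext fun w => ?_
    have hd : HasFDerivAt (fun y : ℝ × ℝ => y + T) (ContinuousLinearMap.id ℝ (ℝ × ℝ)) x :=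
      (hasFDerivAt_id x).add_const T
    have h2 := mfderiv_comp_apply (I := 𝓘(ℝ, ℝ × ℝ)) (f := fun y : ℝ × ℝ => y + T) x
      (hΦ.mdifferentiable (by simp) (x + T)) hd.differentiableAt.mdifferentiableAt w
    rw [mfderiv_eq_fderiv, hd.fderiv] at h2
    exact congrArg (D.form p (Φ (x + T))) h2
  rw [← h1, funext h]

/-- The pullback of a form along `Φ` vanishes in directions that `Φ` collapses. -/
theorem pullbackForm_apply_eq_zero (D : L.Connection) (hΦ : ContMDiff 𝓘(ℝ, ℝ × ℝ) I ∞ Φ)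
    {x w : ℝ × ℝ} (h : ∀ t : ℝ, Φ (x + t • w) = Φ x) (p : B) : D.pullbackForm Φ p x w = 0 :=
  (congrArg (D.form p (Φ x)) (mfderiv_apply_eq_zero hΦ h)).trans (map_zero _)

end Connection

namespace IsoOver

open Connection

/-- The one-form `Φ^*(χ - f^*χ' - dg / g)` on the plane, where `χ` and `χ'` are the local connection
forms around `p` and `q` and `g` is the factor of the bundle map with respect to the frames around
`p` and `q`. It represents the difference of the two connections. -/
def localDifference (A : IsoOver f L L') (D : L.Connection) (D' : L'.Connection) (Φ : ℝ × ℝ → B)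
    (p : B) (q : B') (x : ℝ × ℝ) : ℝ × ℝ →L[ℝ] ℂ :=
  D.pullbackForm Φ p x - D'.pullbackForm (f ∘ Φ) q x - logForm (fun y => A.factor p q (Φ y)) x

/-- The difference of two connections, pulled back to the plane along `Φ`. At `x` it is computed in
the frames around `Φ x` and its image; by `localDifference_eq` every other choice of frames gives
the same value. -/
def difference (A : IsoOver f L L') (D : L.Connection) (D' : L'.Connection) (Φ : ℝ × ℝ → B)
    (x : ℝ × ℝ) : ℝ × ℝ →L[ℝ] ℂ :=
  A.localDifference D D' Φ (Φ x) (f (Φ x)) x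

variable (A : IsoOver f L L') (D : L.Connection) (D' : L'.Connection)

/-- The difference form does not depend on the local frames. -/
theorem localDifference_eq (hf : ContMDiff I I' ∞ f) (hΦ : ContMDiff 𝓘(ℝ, ℝ × ℝ) I ∞ Φ)
    {p p₂ : B} {q q₂ : B'} {x : ℝ × ℝ} (hp : Φ x ∈ L.dom p) (hp₂ : Φ x ∈ L.dom p₂)
    (hq : f (Φ x) ∈ L'.dom q) (hq₂ : f (Φ x) ∈ L'.dom q₂) :
    A.localDifference D D' Φ p₂ q₂ x = A.localDifference D D' Φ p q x := by
  have hfΦ := hf.comp hΦ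
  have hk : ContDiffAt ℝ ∞ (fun y => L.coord p (Φ y) (L.frame p₂ (Φ y))) x :=
    (ContMDiffAt.comp x (contMDiffAt_coord_frame hp hp₂) hΦ.contMDiffAt).contDiffAt
  have hk' : ContDiffAt ℝ ∞
      (fun y => L'.coord q ((f ∘ Φ) y) (L'.frame q₂ ((f ∘ Φ) y))) x :=
    (ContMDiffAt.comp x (contMDiffAt_coord_frame (L := L') hq hq₂) hfΦ.contMDiffAt).contDiffAt
  have h0 : L.coord p (Φ x) (L.frame p₂ (Φ x)) ≠ 0 := coord_ne_zero hp (frame_ne_zero hp₂)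
  have h0' : L'.coord q ((f ∘ Φ) x) (L'.frame q₂ ((f ∘ Φ) x)) ≠ 0 :=
    coord_ne_zero hq (frame_ne_zero hq₂)
  -- Both sides are the coordinate around `q` of the image of the frame around `p₂`.
  have key : (fun y => A.factor p₂ q₂ (Φ y) * L'.coord q ((f ∘ Φ) y) (L'.frame q₂ ((f ∘ Φ) y)))
      =ᶠ[𝓝 x] fun y => A.factor p q (Φ y) * L.coord p (Φ y) (L.frame p₂ (Φ y)) := by
    filter_upwards [hΦ.continuous.continuousAt.preimage_mem_nhds (L.dom_mem_nhds hp),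
      hfΦ.continuous.continuousAt.preimage_mem_nhds (L'.dom_mem_nhds hq₂)] with y hy hy'
    rw [← A.coord_map hy]
    conv_rhs => rw [← coord_smul_frame hy' (A.map (Φ y) (L.frame p₂ (Φ y))), map_smul, smul_eq_mul]
    rfl
  have h1 := logForm_congr key
  have hF := A.contDiffAt_factor_comp hΦ hp hq
  have hF₂ := A.contDiffAt_factor_comp hΦ hp₂ hq₂
  rw [logForm_mul (hF₂.differentiableAt (by simp)) (hk'.differentiableAt (by simp))
      (A.factor_ne_zero hp₂ hq₂) h0',
    logForm_mul (hF.differentiableAt (by simp)) (hk.differentiableAt (by simp))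
      (A.factor_ne_zero hp hq) h0] at h1
  rw [localDifference, localDifference, D.pullbackForm_gauge hΦ hp hp₂,
    D'.pullbackForm_gauge hfΦ hq hq₂, eq_sub_of_add_eq' h1.symm]
  abel

/-- Near a point the difference form is given by one formula in fixed frames. -/
theorem eventually_difference_eq (hf : ContMDiff I I' ∞ f) (hΦ : ContMDiff 𝓘(ℝ, ℝ × ℝ) I ∞ Φ)
    {p : B} {q : B'} {x : ℝ × ℝ} (hp : Φ x ∈ L.dom p) (hq : f (Φ x) ∈ L'.dom q) :
    A.difference D D' Φ =ᶠ[𝓝 x] A.localDifference D D' Φ p q := by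
  filter_upwards [hΦ.continuous.continuousAt.preimage_mem_nhds (L.dom_mem_nhds hp),
    (hf.comp hΦ).continuous.continuousAt.preimage_mem_nhds (L'.dom_mem_nhds hq)] with y hy hy'
  exact A.localDifference_eq D D' hf hΦ hy (L.mem_dom_self _) hy' (L'.mem_dom_self _)

theorem difference_periodic (hf : ContMDiff I I' ∞ f) (hΦ : ContMDiff 𝓘(ℝ, ℝ × ℝ) I ∞ Φ)
    {T : ℝ × ℝ} (h : ∀ x, Φ (x + T) = Φ x) (x : ℝ × ℝ) :
    A.difference D D' Φ (x + T) = A.difference D D' Φ x := by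
  have h1 : ∀ k : B → ℂ, logForm (fun y => k (Φ y)) (x + T) = logForm (fun y => k (Φ y)) x := by
    intro k
    rw [logForm, logForm, ← fderiv_comp_add_right]
    simp only [h]
  rw [difference, difference, h, localDifference, localDifference, D.pullbackForm_periodic hΦ h,
    D'.pullbackForm_periodic (hf.comp hΦ) (fun x => congrArg f (h x)), h1]

theorem difference_apply_eq_zero (hf : ContMDiff I I' ∞ f) (hΦ : ContMDiff 𝓘(ℝ, ℝ × ℝ) I ∞ Φ)
    {x w : ℝ × ℝ} (h : ∀ t : ℝ, Φ (x + t • w) = Φ x) : A.difference D D' Φ x w = 0 := by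
  have h1 : fderiv ℝ (fun y => A.factor (Φ x) (f (Φ x)) (Φ y)) x w = 0 := by
    rw [fderiv_comp_apply hΦ ((A.contMDiffAt_factor (L.mem_dom_self _)
      (L'.mem_dom_self _)).mdifferentiableAt (by simp)), mfderiv_apply_eq_zero hΦ h, map_zero]
  simp [difference, localDifference, logForm, D.pullbackForm_apply_eq_zero hΦ h,
    D'.pullbackForm_apply_eq_zero (hf.comp hΦ) (fun t => congrArg f (h t)), h1]

variable [FiniteDimensional ℝ EB] [T2Space B] [SigmaCompactSpace B]
  [FiniteDimensional ℝ EB'] [T2Space B'] [SigmaCompactSpace B']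

theorem contDiff_difference (hf : ContMDiff I I' ∞ f) (hΦ : ContMDiff 𝓘(ℝ, ℝ × ℝ) I ∞ Φ) :
    ContDiff ℝ ∞ (A.difference D D' Φ) := by
  refine contDiff_iff_contDiffAt.2 fun x => ?_
  have hp := L.mem_dom_self (Φ x)
  have hq := L'.mem_dom_self (f (Φ x))
  refine ContDiffAt.congr_of_eventuallyEq ?_ (A.eventually_difference_eq D D' hf hΦ hp hq)
  exact ((D.contDiffAt_pullbackForm hΦ hp).sub (D'.contDiffAt_pullbackForm (hf.comp hΦ) hq)).sub
    (contDiffAt_logForm (A.contDiffAt_factor_comp hΦ hp hq) (A.factor_ne_zero hp hq))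

/-- The curvatures of two connections that are related by a bundle map differ by the exterior
derivative of the difference form. -/
theorem curl_difference (hf : ContMDiff I I' ∞ f) (hΦ : ContMDiff 𝓘(ℝ, ℝ × ℝ) I ∞ Φ)
    (x : ℝ × ℝ) : curl (A.difference D D' Φ) x =
      D.curvatureAlong Φ x - D'.curvatureAlong (f ∘ Φ) x := by
  have hp := L.mem_dom_self (Φ x)
  have hq := L'.mem_dom_self (f (Φ x))
  have hF := A.contDiffAt_factor_comp hΦ hp hq
  have h0 := A.factor_ne_zero hp hq
  have h1 := (D.contDiffAt_pullbackForm hΦ hp).differentiableAt (by simp)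
  have h2 := (D'.contDiffAt_pullbackForm (hf.comp hΦ) hq).differentiableAt (by simp)
  rw [curl_congr (A.eventually_difference_eq D D' hf hΦ hp hq)]
  refine (curl_sub (h1.sub h2) ((contDiffAt_logForm hF h0).differentiableAt (by simp))).trans ?_
  rw [curl_logForm hF h0, sub_zero]
  exact curl_sub h1 h2

end IsoOver

end Difference

end HermitianLineBundle

/-! ### Existence of connections -/

namespace HermitianLineBundle

section Existence

variable {EB HB : Type*} [NormedAddCommGroup EB] [NormedSpace ℝ EB] [TopologicalSpace HB]
  {I : ModelWithCorners ℝ EB HB} {B : Type*} [TopologicalSpace B] [ChartedSpace HB B]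
  {L : HermitianLineBundle.{u} I B}

/-- The flat local covariant derivative for which the local frame around `p` is parallel. -/
def localCov (L : HermitianLineBundle.{u} I B) (p : B) (σ : ∀ x, L.Fiber x) (x : B) :
    TangentSpace I x →L[ℝ] L.Fiber x :=
  (mvfderiv I (fun y => L.coord p y (σ y)) x).smulRight (L.frame p x)

theorem isCovariantDerivativeOn_localCov (p : B) :
    IsCovariantDerivativeOn ℂ (L.localCov p) (L.dom p) where
  add {σ σ' x} hσ hσ' hx := by
    have h := mvfderiv_add (mdifferentiableAt_coord hx hσ) (mdifferentiableAt_coord hx hσ')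
    ext X
    have h1 : (fun y => L.coord p y ((σ + σ') y)) =
        (fun y => L.coord p y (σ y)) + fun y => L.coord p y (σ' y) := by
      funext y
      simp
    simp only [localCov]
    rw [h1, h]
    simp [add_smul]
  leibniz {σ g x} hσ hg hx := by
    have h := mvfderiv_smul hg (mdifferentiableAt_coord hx hσ)
    ext X
    have h1 : (fun y => L.coord p y ((g • σ) y)) = g • fun y => L.coord p y (σ y) := by
      funext y
      simp only [Pi.smul_apply', LinearMap.map_smul_of_tower]
    simp only [localCov]
    rw [h1, h]
    simp only [add_apply, smul_apply, ContinuousLinearMap.smulRight_apply, add_smul, smul_assoc,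
      coord_smul_frame hx]

variable [IsManifold I ∞ B]

/-- The local covariant derivative is smooth: in the coordinates around `x` it is the differential
of a coordinate function, multiplied by a transition function. -/
theorem contMDiffOn_localCov (p : B) {σ : ∀ x, L.Fiber x}
    (hσ : ContMDiff I (I.prod 𝓘(ℝ, ℂ)) ∞ (fun y => (⟨y, σ y⟩ : L.Total))) :
    ContMDiffOn I (I.prod 𝓘(ℝ, EB →L[ℝ] ℂ)) ∞ (fun x => (⟨x, L.localCov p σ x⟩ :
      TotalSpace (EB →L[ℝ] ℂ) fun x => TangentSpace I x →L[ℝ] L.Fiber x)) (L.dom p) := by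
  intro x hx
  refine ContMDiffAt.contMDiffWithinAt ?_
  rw [contMDiffAt_hom_bundle]
  refine ⟨contMDiffAt_id, ?_⟩
  have hk : ContMDiffAt I 𝓘(ℝ, ℂ) ∞ (fun y => L.coord p y (σ y)) x :=
    ((contMDiffAt_total_iff hx).1 hσ.contMDiffAt).2
  have hd := hk.mfderiv_const (m := ∞) le_rfl
  have hc := contMDiffAt_coord_frame (L.mem_dom_self x) hx
  have hm : ContMDiffAt I 𝓘(ℝ, ℂ →L[ℝ] ℂ) ∞
      (fun y => ContinuousLinearMap.mul ℝ ℂ (L.coord x y (L.frame p y))) x :=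
    (ContinuousLinearMap.mul ℝ ℂ).contDiff.contMDiff.contMDiffAt.comp x hc
  refine (hm.clm_comp hd).congr_of_eventuallyEq ?_
  filter_upwards [L.dom_mem_nhds (L.mem_dom_self x)] with y hy
  ext v
  have h : ∀ w, (trivializationAt ℂ L.Fiber x).linearMapAt ℝ y w = L.coord x y w := fun w => by
    rw [coord_apply hy]
    exact congrFun (Trivialization.coe_linearMapAt_of_mem (R := ℝ) _ hy) w
  simp only [ContinuousLinearMap.inCoordinates, inTangentCoordinates, localCov,
    ContinuousLinearMap.coe_comp, Function.comp_apply, ContinuousLinearMap.smulRight_apply,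
    Trivialization.continuousLinearMapAt_apply, ContinuousLinearMap.mul_apply',
    TangentBundle.continuousLinearMapAt_model_space, h, map_smul, smul_eq_mul]
  exact mul_comm _ _

variable [FiniteDimensional ℝ EB] [T2Space B] [CompactSpace B]

/-- Every line bundle over a compact manifold has a connection: flat local ones are averaged by a
partition of unity. -/
theorem nonempty_connection (L : HermitianLineBundle.{u} I B) : Nonempty L.Connection := by
  obtain ⟨J, ρ, hρ, hsub, hsum⟩ := exists_finite_partition I L.dom L.isOpen_dom L.mem_dom_self
  have hdom : ∀ i x, ρ i x ≠ 0 → x ∈ L.dom i := fun i x h => hsub i (subset_tsupport _ h)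
  let D : CovariantDerivative I ℂ L.Fiber :=
    { toFun := fun σ x => ∑ i, ρ i x • L.localCov i σ x
      isCovariantDerivativeOnUniv :=
        { add := fun {σ σ' x} hσ hσ' _ => by
            rw [← Finset.sum_add_distrib]
            refine Finset.sum_congr rfl fun i _ => ?_
            by_cases hi : ρ i x = 0
            · simp [hi]
            · rw [(isCovariantDerivativeOn_localCov (L := L) i).add hσ hσ' (hdom i x hi), smul_add]
          leibniz := fun {σ g x} hσ hg _ => by
            have h1 : ∀ i : J, ρ i x • L.localCov i (g • σ) x = g x • ρ i x • L.localCov i σ x +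
                ρ i x • (mvfderiv I g x).smulRight (σ x) := by
              intro i
              by_cases hi : ρ i x = 0
              · simp [hi]
              · rw [(isCovariantDerivativeOn_localCov (L := L) i).leibniz hσ hg (hdom i x hi),
                  smul_add, smul_comm]
            rw [Finset.sum_congr rfl fun i _ => h1 i, Finset.sum_add_distrib, ← Finset.smul_sum,
              ← Finset.sum_smul, hsum, one_smul] } }
  refine ⟨⟨D, ⟨⟨fun {σ} hσ => ?_⟩⟩, fun c σ x hσ X => ?_⟩⟩
  · rw [contMDiffOn_univ]
    exact ContMDiff.sum_section fun i _ => ContMDiffOn.smul_section_of_tsupport (u := L.dom i)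
      (hρ i).contMDiffOn (L.isOpen_dom _) (hsub i)
      (contMDiffOn_localCov (L := L) i (contMDiffOn_univ.1 hσ))
  · have h1 : ∀ i : J, (ρ i x • L.localCov i (fun y => c • σ y) x) X =
        c • (ρ i x • L.localCov i σ x) X := by
      intro i
      by_cases hi : ρ i x = 0
      · simp [hi]
      · have h2 : mvfderiv I (fun y => L.coord i y (c • σ y)) x X =
            c * mvfderiv I (fun y => L.coord i y (σ y)) x X := by
          simp only [map_smul, smul_eq_mul]
          have h3 := mfderiv_comp x
            ((ContinuousLinearMap.mul ℝ ℂ c).differentiableAt (x := L.coord i x (σ x))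
              ).mdifferentiableAt (mdifferentiableAt_coord (hdom i x hi) hσ)
          rw [mfderiv_eq_fderiv, ContinuousLinearMap.fderiv] at h3
          exact congr($h3 X)
        simp only [localCov, smul_apply, ContinuousLinearMap.smulRight_apply, h2, mul_smul]
        rw [smul_comm]
    change (∑ i, ρ i x • L.localCov i (fun y => c • σ y) x) X =
      c • (∑ i, ρ i x • L.localCov i σ x) X
    rw [sum_apply, sum_apply,
      Finset.sum_congr rfl fun i _ => h1 i, Finset.smul_sum]

end Existence

end HermitianLineBundle

/-! ### The first Chern number on spheres -/

namespace Sphere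

instance (r : ℝ) (hr : 0 < r) : T2Space (Sphere r hr) := (Sphere.scale r hr).symm.t2Space

instance (r : ℝ) (hr : 0 < r) : CompactSpace (Sphere r hr) := (Sphere.scale r hr).symm.compactSpace

theorem spherical_periodic (r : ℝ) (hr : 0 < r) (x : ℝ × ℝ) :
    spherical r hr (x + (0, 2 * Real.pi)) = spherical r hr x := by
  refine Subtype.ext ?_
  simp [spherical]

/-- On the lines that parametrize the poles the spherical coordinates are constant. -/
theorem spherical_const_of_sin_eq_zero (r : ℝ) (hr : 0 < r) {u : ℝ} (hu : Real.sin u = 0)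
    (v t : ℝ) : spherical r hr ((u, v) + t • (0, 1)) = spherical r hr (u, v) := by
  refine Subtype.ext ?_
  simp [spherical, hu]

/-- The radial map `q ↦ (s / r) q` between spheres. -/
def radial (r : ℝ) (hr : 0 < r) (s : ℝ) (hs : 0 < s) :
    Diffeomorph (𝓡 2) (𝓡 2) (Sphere r hr) (Sphere s hs) ∞ where
  toEquiv := ((scale r hr).trans (scale s hs).symm).toEquiv
  contMDiff_toFun := (contMDiff_scale_symm s hs).comp (contMDiff_scale r hr)
  contMDiff_invFun := (contMDiff_scale_symm r hr).comp (contMDiff_scale s hs)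

theorem radial_self (r : ℝ) (hr : 0 < r) (q : Sphere r hr) : radial r hr r hr q = q :=
  (scale r hr).symm_apply_apply q

theorem radial_spherical (r : ℝ) (hr : 0 < r) (s : ℝ) (hs : 0 < s) (x : ℝ × ℝ) :
    radial r hr s hs (spherical r hr x) = spherical s hs x :=
  Subtype.ext (congrArg (s • ·) (inv_smul_smul₀ hr.ne' _))

end Sphere

namespace HermitianLineBundle

section ChernNumber

variable {r : ℝ} {hr : 0 < r} {L : HermitianLineBundle.{u} (𝓡 2) (Sphere r hr)}
  {s : ℝ} {hs : 0 < s} {L' : HermitianLineBundle.{u} (𝓡 2) (Sphere s hs)}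

/-- The integral of the first Chern form is invariant under bundle maps covering a map of spheres
that is compatible with the spherical coordinates. The identity map of a bundle is the special case
of independence of the connection. -/
theorem IsoOver.chernIntegral_eq {f : Sphere r hr → Sphere s hs} (A : IsoOver f L L')
    (hf : ContMDiff (𝓡 2) (𝓡 2) ∞ f)
    (hfs : ∀ x, f (Sphere.spherical r hr x) = Sphere.spherical s hs x)
    (D : L.Connection) (D' : L'.Connection) : D.chernIntegral = D'.chernIntegral := by
  have hΦ := Sphere.contMDiff_spherical r hr
  have hΦ' := Sphere.contMDiff_spherical s hs
  have hcomp : f ∘ Sphere.spherical r hr = Sphere.spherical s hs := funext hfs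
  have h1 := integral_curl_eq_zero (A.contDiff_difference D D' hf hΦ)
    (fun u v => by
      simpa using A.difference_periodic D D' hf hΦ (Sphere.spherical_periodic r hr) (u, v))
    (fun v => A.difference_apply_eq_zero D D' hf hΦ
      (Sphere.spherical_const_of_sin_eq_zero r hr Real.sin_zero v))
    (fun v => A.difference_apply_eq_zero D D' hf hΦ
      (Sphere.spherical_const_of_sin_eq_zero r hr Real.sin_pi v))
  simp only [A.curl_difference D D' hf hΦ, hcomp] at h1
  -- It remains to split the iterated integral of the difference; the integrands are continuous.
  have hc := D.continuous_curvatureAlong hΦ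
  have hc' := D'.continuous_curvatureAlong hΦ'
  have hin : ∀ {F : ℝ × ℝ → ℂ}, Continuous F → ∀ u,
      IntervalIntegrable (fun v => F (u, v)) MeasureTheory.volume 0 (2 * Real.pi) :=
    fun hF u => (hF.comp (by fun_prop : Continuous fun v : ℝ => (u, v))).intervalIntegrable _ _
  have hout : ∀ {F : ℝ × ℝ → ℂ}, Continuous F → IntervalIntegrable
      (fun u => ∫ v in (0 : ℝ)..(2 * Real.pi), F (u, v)) MeasureTheory.volume 0 Real.pi :=
    fun {F} hF => (intervalIntegral.continuous_parametric_intervalIntegral_of_continuous'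
      (f := fun u v => F (u, v)) hF _ _).intervalIntegrable _ _
  simp only [intervalIntegral.integral_sub (hin hc _) (hin hc' _)] at h1
  rw [intervalIntegral.integral_sub (hout hc) (hout hc'), sub_eq_zero] at h1
  simp only [Connection.chernIntegral, intervalIntegral.integral_const_mul, h1]

/-- Bundles that are related by a bundle map as in `IsoOver.chernIntegral_eq` have the same first
Chern number. -/
theorem IsoOver.isFirstChernNumber {f : Sphere r hr → Sphere s hs} (A : IsoOver f L L')
    (hf : ContMDiff (𝓡 2) (𝓡 2) ∞ f)
    (hfs : ∀ x, f (Sphere.spherical r hr x) = Sphere.spherical s hs x)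
    (D : L.Connection) : L'.IsFirstChernNumber D.chernIntegral :=
  ⟨nonempty_connection L', fun D' => (A.chernIntegral_eq hf hfs D D').symm⟩

end ChernNumber

end HermitianLineBundle

end WeylSphere

end

/-! ### The Chern number of a bundle over a shell or a punctured ball -/

theorem mainTheorem1 :
    -- the shell: (i) the boundary restrictions are isomorphic, (ii) with the same Chern number
    (∀ (a b : ℝ) (ha : 0 < a) (hab : a < b)
      (E : HermitianLineBundle.{u} shellModel (Shell a b ha hab)),
      E.restrictInner.Isomorphic E.restrictOuter ∧
      ∃ n : ℂ, E.restrictInner.IsFirstChernNumber n ∧ E.restrictOuter.IsFirstChernNumber n) ∧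
    -- (iii) the topological charge of an isolated singular point at the origin
    (∀ (R : ℝ), 0 < R → ∀ E : HermitianLineBundle.{u} 𝓘(ℝ, R3) (puncturedBall R),
      ∃ n : ℂ, ∀ (r : ℝ) (hr : 0 < r) (hrR : r < R),
        (E.restrictSphere r hr hrR).IsFirstChernNumber n) := by
  refine ⟨fun a b ha hab E => ?_, fun R hR E => ?_⟩
  · have hpos : ∀ t : Set.Icc a b, 0 < t.1 := fun t => ha.trans_le t.2.1
    -- The radial maps from the inner sphere to the spheres of radius `t` form a homotopy `F` of
    -- maps into the shell, from the inclusion of the inner sphere to a map onto the outer one.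
    let σ : ∀ t : Set.Icc a b, ContMDiffMap (𝓡 2) (𝓡 2) (Sphere a ha) (Sphere t.1 (hpos t)) ∞ :=
      fun t => ⟨Sphere.radial a ha t (hpos t), (Sphere.radial a ha t (hpos t)).contMDiff⟩
    let F : Set.Icc a b → ContMDiffMap (𝓡 2) shellModel (Sphere a ha) (Shell a b ha hab) ∞ :=
      fun t => (Sphere.toShell ha hab t (hpos t) t.2.1 t.2.2).comp (σ t)
    have hF : Continuous fun z : Set.Icc a b × Sphere a ha => F z.1 z.2 :=
      Continuous.subtype_mk ((continuous_subtype_val.comp continuous_fst).smul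
        (((Sphere.continuous_val a ha).comp continuous_snd).const_smul a⁻¹)) _
    have : PreconnectedSpace (Set.Icc a b) := Subtype.preconnectedSpace isPreconnected_Icc
    obtain ⟨A⟩ := HermitianLineBundle.nonempty_isoOver_pullback (E := E) F hF
      ⟨a, le_rfl, hab.le⟩ ⟨b, hab.le, le_rfl⟩
    have h0 : F ⟨a, le_rfl, hab.le⟩ = Sphere.toShell ha hab a ha le_rfl hab.le :=
      ContMDiffMap.ext fun q => congrArg (Sphere.toShell ha hab a ha le_rfl hab.le)
        (Sphere.radial_self a ha q)
    rw [h0] at A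
    -- Composing with the canonical map of a pullback gives a bundle map covering the radial map.
    have A' : HermitianLineBundle.IsoOver (Sphere.radial a ha b (ha.trans hab))
        E.restrictInner E.restrictOuter :=
      A.trans (HermitianLineBundle.IsoOver.pullbackComp E
        (Sphere.toShell ha hab b (ha.trans hab) hab.le le_rfl)
        (σ ⟨b, hab.le, le_rfl⟩))
    obtain ⟨D⟩ := HermitianLineBundle.nonempty_connection E.restrictInner
    exact ⟨A'.isomorphic, D.chernIntegral,
      (HermitianLineBundle.IsoOver.refl _).isFirstChernNumber contMDiff_id (fun _ => rfl) D,
      A'.isFirstChernNumber (Sphere.radial a ha b (ha.trans hab)).contMDiff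
        (Sphere.radial_spherical a ha b _) D⟩
  · -- All spheres are compared with the one of radius `R / 2`.
    have ha : 0 < R / 2 := half_pos hR
    let σ : ∀ t : Set.Ioo 0 R, ContMDiffMap (𝓡 2) (𝓡 2) (Sphere (R / 2) ha) (Sphere t.1 t.2.1) ∞ :=
      fun t => ⟨Sphere.radial _ ha t t.2.1, (Sphere.radial _ ha t t.2.1).contMDiff⟩
    let F : Set.Ioo 0 R → ContMDiffMap (𝓡 2) 𝓘(ℝ, R3) (Sphere (R / 2) ha) (puncturedBall R) ∞ :=
      fun t => (Sphere.toPuncturedBall t t.2.1 t.2.2).comp (σ t)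
    have hF : Continuous fun z : Set.Ioo 0 R × Sphere (R / 2) ha => F z.1 z.2 :=
      Continuous.subtype_mk ((continuous_subtype_val.comp continuous_fst).smul
        (((Sphere.continuous_val _ ha).comp continuous_snd).const_smul (R / 2)⁻¹)) _
    have : PreconnectedSpace (Set.Ioo 0 R) := Subtype.preconnectedSpace isPreconnected_Ioo
    have h0 : F ⟨R / 2, ha, half_lt_self hR⟩ =
        Sphere.toPuncturedBall (R / 2) ha (half_lt_self hR) :=
      ContMDiffMap.ext fun q => congrArg (Sphere.toPuncturedBall (R / 2) ha (half_lt_self hR))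
        (Sphere.radial_self _ ha q)
    obtain ⟨D⟩ := HermitianLineBundle.nonempty_connection
      (E.restrictSphere (R / 2) ha (half_lt_self hR))
    refine ⟨D.chernIntegral, fun r hr hrR => ?_⟩
    obtain ⟨A⟩ := HermitianLineBundle.nonempty_isoOver_pullback (E := E) F hF
      ⟨R / 2, ha, half_lt_self hR⟩ ⟨r, hr, hrR⟩
    rw [h0] at A
    -- Composing with the canonical map of a pullback gives a bundle map covering the radial map.
    have A' : HermitianLineBundle.IsoOver (Sphere.radial _ ha r hr)
        (E.restrictSphere (R / 2) ha (half_lt_self hR))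
        (E.restrictSphere r hr hrR) :=
      A.trans (HermitianLineBundle.IsoOver.pullbackComp E
        (Sphere.toPuncturedBall r hr hrR) (σ ⟨r, hr, hrR⟩))
    exact A'.isFirstChernNumber (Sphere.radial _ ha r hr).contMDiff
      (Sphere.radial_spherical _ ha r hr) D
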